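/- Let $M$ be a compact smooth manifold without boundary (Hausdorff, of pure dimension $\ge 1$, not necessarily connected or orientable), and let $X$ be a smooth nowhere-vanishing vector field on $M$ all of whose orbits are closed (i.e. every integral curve is periodic). Suppose that the set of lengths of the orbits of $X$, measured with respect to some Riemannian metric on $M$, is bounded above. Then there is a smooth Riemannian metric $g$ on $M$ for which $X$ is a Beltrami-type stationary solution of the Euler equations; that is, writing $\alpha = g(X,\cdot)$ and $\mu$ for the Riemannian volume form of $g$, there is a smooth function $B : M \to \mathbb{R}$ (the Bernoulli function) with $$\iota_X\, d\alpha = -dB, \qquad d\,\iota_X \mu = 0,$$ and $B$ is constant, so that $\iota_X\, d\alpha = 0$. (If $M$ is not orientable, $d\,\iota_X\mu = 0$ is required of the local Riemannian volume forms; the condition does not depend on the choice of their sign.) -/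

import Mathlib

open scoped Manifold ContDiff

noncomputable section

namespace SteadyEuler

/-- The Euclidean model space of dimension `n`. -/
abbrev Model (n : ℕ) : Type := EuclideanSpace ℝ (Fin n)

section Forms

variable {n : ℕ} {M : Type*} [TopologicalSpace M] [ChartedSpace (Model n) M]

/-- The tangent space of the `n`-manifold `M` at `x`. -/
abbrev Tan (n : ℕ) {M : Type*} [TopologicalSpace M] [ChartedSpace (Model n) M] (x : M) : Type :=
  TangentSpace (𝓡 n) x

/-- (Not necessarily smooth) differential `k`-forms on `M`. -/
abbrev Form (n : ℕ) (M : Type*) [TopologicalSpace M] [ChartedSpace (Model n) M] (k : ℕ) : Type _ :=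
  ∀ x : M, Tan n x [⋀^Fin k]→L[ℝ] ℝ

/-- Smooth Riemannian metrics on `M`. -/
abbrev Metric (n : ℕ) (M : Type*) [TopologicalSpace M] [ChartedSpace (Model n) M]
    [IsManifold (𝓡 n) ∞ M] : Type _ :=
  Bundle.ContMDiffRiemannianMetric (𝓡 n) ∞ (Model n) (fun x : M => Tan n x)

/-- Smoothness of a vector field, as a section of the tangent bundle. -/
def IsSmoothField [IsManifold (𝓡 n) ∞ M] (X : ∀ x : M, Tan n x) : Prop :=
  ContMDiff (𝓡 n) (𝓡 n).tangent ∞ (fun x : M => (⟨x, X x⟩ : TangentBundle (𝓡 n) M))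

/-- The expression of a form in the preferred chart `φ` around `p`, that is, the pullback
`(φ⁻¹)^* η`, a form on the (open) target of `φ`. -/
def Form.inChart {k : ℕ} (η : Form n M k) (p : M) : Model n → Model n [⋀^Fin k]→L[ℝ] ℝ := fun y =>
  (η ((extChartAt (𝓡 n) p).symm y)).compContinuousLinearMap
    (mfderiv 𝓘(ℝ, Model n) (𝓡 n) (extChartAt (𝓡 n) p).symm y)

/-- The exterior derivative of a form on `M`: at the point `x` it is `φ^* d((φ⁻¹)^* η)`, where `φ`
is the preferred chart around `x`. -/
def Form.d {k : ℕ} (η : Form n M k) : Form n M (k + 1) := fun x =>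
  (extDeriv (η.inChart x) (extChartAt (𝓡 n) x x)).compContinuousLinearMap
    (mfderiv (𝓡 n) 𝓘(ℝ, Model n) (extChartAt (𝓡 n) x) x)

/-- The interior product `ι_X η = η(X, ·, …, ·)`. -/
def Form.interior {k : ℕ} (X : ∀ x : M, Tan n x) (η : Form n M (k + 1)) : Form n M k := fun x =>
  ContinuousAlternatingMap.curryLeft (E := Model n) (η x) (X x)

/-- The one-form given by a family of continuous linear forms on the tangent spaces. -/
def oneForm (a : ∀ x : M, Tan n x →L[ℝ] ℝ) : Form n M 1 := fun x =>
  ContinuousAlternatingMap.ofSubsingleton ℝ (Tan n x) ℝ (0 : Fin 1) (a x)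

/-- The differential of a function, as a one-form. -/
def differential (B : M → ℝ) : Form n M 1 := oneForm fun x => mfderiv (𝓡 n) 𝓘(ℝ, ℝ) B x

/-- The standard volume form `dx¹ ∧ ⋯ ∧ dxⁿ` of the model space. -/
def stdVol (n : ℕ) : Model n [⋀^Fin n]→L[ℝ] ℝ :=
  { (EuclideanSpace.basisFun (Fin n) ℝ).toBasis.det with
    cont := by
      have h : Continuous fun v : Fin n → Model n =>
          (Matrix.of fun i j => v j i : Matrix (Fin n) (Fin n) ℝ).det := by
        refine Continuous.matrix_det ?_
        refine continuous_matrix fun i j => ?_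
        simp only [Matrix.of_apply]
        fun_prop
      exact h }

end Forms

section Euler

variable {n : ℕ} {M : Type*} [TopologicalSpace M] [ChartedSpace (Model n) M]
  [IsManifold (𝓡 n) ∞ M]

/-- The one-form `α = g(X, ·)` dual to the vector field `X`. -/
def dualForm (g : Metric n M) (X : ∀ x : M, Tan n x) : Form n M 1 :=
  oneForm fun x => g.inner x (X x)

/-- The coordinate vector `∂_i` at the point `x`, for the preferred chart around `p`
(meaningful for `x` in the domain of this chart). -/
def coordVector (p : M) (i : Fin n) (x : M) : Tan n x :=
  mfderiv 𝓘(ℝ, Model n) (𝓡 n) (extChartAt (𝓡 n) p).symm (extChartAt (𝓡 n) p x)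
    (EuclideanSpace.basisFun (Fin n) ℝ i)

/-- The Riemannian volume form `√(det g_ij) dx¹ ∧ ⋯ ∧ dxⁿ` of `g` in the preferred chart around `p`,
for the orientation of the domain of the chart that makes the chart orientation preserving
(meaningful on the domain of the chart). -/
def volumeForm (g : Metric n M) (p : M) : Form n M n := fun x =>
  √(Matrix.of fun i j => g.inner x (coordVector p i x) (coordVector p j x)).det •
    (stdVol n).compContinuousLinearMap (mfderiv (𝓡 n) 𝓘(ℝ, Model n) (extChartAt (𝓡 n) p) x)

/-- The lengths, measured by the metric `g`, of the closed orbits of `X`: the length of the orbit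
of an integral curve `γ` with least positive period `T` is the integral of `|γ'| = |X ∘ γ|` over
`[0, T]`. -/
def orbitLengths (g : Metric n M) (X : ∀ x : M, Tan n x) : Set ℝ :=
  {ℓ | ∃ (γ : ℝ → M) (T : ℝ), IsMIntegralCurve (I := 𝓡 n) γ X ∧
    IsLeast {S : ℝ | 0 < S ∧ Function.Periodic γ S} T ∧
    ℓ = ∫ t in (0 : ℝ)..T, √(g.inner (γ t) (X (γ t)) (X (γ t)))}

/-- All orbits of `X` are closed: every integral curve is periodic. -/
def AllOrbitsClosed (X : ∀ x : M, Tan n x) : Prop :=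
  ∀ γ : ℝ → M, IsMIntegralCurve (I := 𝓡 n) γ X → ∃ T : ℝ, 0 < T ∧ Function.Periodic γ T

end Euler

section Stationary

variable {n : ℕ} {M : Type*} [TopologicalSpace M] [ChartedSpace (Model (n + 1)) M]
  [IsManifold (𝓡 (n + 1)) ∞ M]

/-- The vector field `X` preserves the Riemannian volume of `g`: `d ι_X μ = 0` near every point `p`,
where `μ` is the Riemannian volume form near `p`. The condition does not change when `μ` is replaced
by `-μ`, so no orientation of `M` is needed; on an oriented manifold `μ` is, up to sign, the
restriction of the global Riemannian volume form. -/
def PreservesVolume (g : Metric (n + 1) M) (X : ∀ x : M, Tan (n + 1) x) : Prop :=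
  ∀ p : M, ((volumeForm g p).interior X).d p = 0

/-- `X` solves the stationary Euler equations on `(M, g)` with the (smooth) Bernoulli function `B`:
`ι_X dα = -dB` for `α = g(X, ·)`, and `d ι_X μ = 0` for the Riemannian volume form `μ`. -/
structure IsStationaryEuler (g : Metric (n + 1) M) (X : ∀ x : M, Tan (n + 1) x) (B : M → ℝ) :
    Prop where
  smooth : ContMDiff (𝓡 (n + 1)) 𝓘(ℝ, ℝ) ∞ B
  momentum : (dualForm g X).d.interior X = -differential B
  volume : PreservesVolume g X

/-- `X` is a Beltrami-type stationary solution of the Euler equations on `(M, g)`: a stationary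
solution whose Bernoulli function is constant. -/
def IsBeltramiType (g : Metric (n + 1) M) (X : ∀ x : M, Tan (n + 1) x) : Prop :=
  ∃ B : M → ℝ, IsStationaryEuler g X B ∧ ∃ c : ℝ, ∀ x, B x = c

end Stationary

end SteadyEuler

end

/-! Suppose first that `X` has been rescaled by a positive invariant function `T` so that `Y = T X`
generates a circle action, that is, a flow of period one. Averaging over the circle gives a
`Y`-invariant metric `g`. If moreover `g(Y, Y) = T`, then `α = g(X, ·)` satisfies `α(Y) = 1`. Since
`T` is invariant, `Y` commutes with `X`, so `L_Y α = 0`, and Cartan's formula gives `ι_Y dα = L_Y α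
- d(α(Y)) = 0`, whence `ι_X dα = 0`. Likewise `L_Y μ = 0`, and dividing by `T` keeps the divergence
zero because `T` is constant along `X`. The Bernoulli function is then zero. The prescribed length
costs nothing: scale any metric conformally before averaging, and the invariance of `T` makes the
average keep the value.

The real content is the existence of a smooth `T` whose values are periods. By compactness `|X|` is
bounded below, so bounded lengths give bounded least periods (`IsFlow.exists_period_bound`). The
least period itself can jump at exceptional orbits, so `T x` is taken to be the least positive value
at `x` of a continuous germ of periods. Three facts make this work. A germ of periods is a branch of
the smooth local return time, hence is smooth and determined by its value
(`IsFlow.exists_return_time`). Positive germs exist: at a point of least period `τ`, nearby periods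
are close to `kτ` with `k` bounded, so a return time close to a large factorial multiple of `τ` is a
period at all nearby points (`IsFlow.exists_pos_mem_germPeriods`). Finally, a germ divisible by `k`
at points accumulating at `p` is divisible by `k` at `p` (`IsPeriodGerm.div_natCast`): the
corresponding root of the identity has differential the identity at `p` by continuity, and a germ of
finite order tangent to the identity is trivial. So `T` agrees with a single germ near each point.

The smooth flow and the smoothness of averages both rest on the smoothness of `γ ↦ f ∘ γ` on spaces
of continuous curves. The Lie derivative computations are carried out at the centre of a chart. -/

namespace SteadyEuler

open Set Filter Topology

/-! ### Superposition operators on spaces of continuous maps. -/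

section Superposition

variable {K : Type*} [TopologicalSpace K] [CompactSpace K]
variable {E F : Type} [NormedAddCommGroup E] [NormedSpace ℝ E] [NormedAddCommGroup F]
  [NormedSpace ℝ F]

/-- Pointwise application of a continuous family of operators, as a bounded bilinear map. -/
noncomputable def pointwiseApplyL (K : Type*) [TopologicalSpace K] [CompactSpace K] (E F : Type)
    [NormedAddCommGroup E] [NormedSpace ℝ E] [NormedAddCommGroup F] [NormedSpace ℝ F] :
    C(K, E →L[ℝ] F) →L[ℝ] C(K, E) →L[ℝ] C(K, F) :=
  LinearMap.mkContinuous₂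
    (LinearMap.mk₂ ℝ (fun (A : C(K, E →L[ℝ] F)) (γ : C(K, E)) =>
        (⟨fun s => A s (γ s), by fun_prop⟩ : C(K, F)))
      (fun A B γ => by ext; simp) (fun c A γ => by ext; simp)
      (fun A γ δ => by ext; simp) (fun c A γ => by ext; simp)) 1 (by
    intro A γ
    rw [one_mul, ContinuousMap.norm_le _ (by positivity)]
    intro s
    exact (A s).le_of_opNorm_le_of_le (A.norm_coe_le_norm s) (γ.norm_coe_le_norm s))

/-- The inclusion of the constant maps. -/
noncomputable def constL (K : Type*) [TopologicalSpace K] [CompactSpace K] (E : Type)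
    [NormedAddCommGroup E] [NormedSpace ℝ E] : E →L[ℝ] C(K, E) :=
  LinearMap.mkContinuous
    ({ toFun := fun x => ContinuousMap.const K x
       map_add' := fun _ _ => rfl
       map_smul' := fun _ _ => rfl } : E →ₗ[ℝ] C(K, E)) 1 (fun x => by
    rw [one_mul, ContinuousMap.norm_le _ (norm_nonneg _)]
    exact fun _ => le_rfl)

/-- The range of `γ` is compact, so the derivative of `f` is uniformly continuous along it; this
makes the pointwise mean value estimate uniform over `K`. -/
theorem hasFDerivAt_superposition {f : E → F} (hf : ContDiff ℝ 1 f) (γ : C(K, E)) :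
    HasFDerivAt (fun γ : C(K, E) => (ContinuousMap.mk f hf.continuous).comp γ)
      (pointwiseApplyL K E F
        ((ContinuousMap.mk (fderiv ℝ f) (hf.continuous_fderiv one_ne_zero)).comp γ)) γ := by
  rw [hasFDerivAt_iff_isLittleO_nhds_zero, Asymptotics.isLittleO_iff]
  intro ε hε
  have hc := (isCompact_range γ.continuous).uniformContinuousAt_of_continuousAt (fderiv ℝ f)
    (fun a _ => (hf.continuous_fderiv one_ne_zero).continuousAt) (Metric.dist_mem_uniformity hε)
  obtain ⟨δ, hδ, hδ'⟩ := Metric.mem_uniformity_dist.1 hc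
  filter_upwards [Metric.ball_mem_nhds (0 : C(K, E)) hδ] with h hh
  rw [ContinuousMap.norm_le _ (by positivity)]
  intro s
  simp only [ContinuousMap.sub_apply, ContinuousMap.comp_apply, ContinuousMap.add_apply,
    ContinuousMap.coe_mk]
  have hhs : ‖h s‖ < δ := (h.norm_coe_le_norm s).trans_lt (by simpa using hh)
  have key : ‖f (γ s + h s) - f (γ s) - fderiv ℝ f (γ s) (γ s + h s - γ s)‖
      ≤ ε * ‖γ s + h s - γ s‖ := by
    refine (convex_ball (γ s) δ).norm_image_sub_le_of_norm_fderivWithin_le' (𝕜 := ℝ)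
      (fun z _ => (hf.differentiable one_ne_zero z).differentiableWithinAt) ?_
      (Metric.mem_ball_self hδ) (by simpa using hhs)
    intro z hz
    rw [fderivWithin_of_isOpen Metric.isOpen_ball hz, ← dist_eq_norm, dist_comm]
    exact le_of_lt (hδ' (a := γ s) (b := z) (by rw [dist_comm]; exact hz) (mem_range_self s))
  rw [add_sub_cancel_left] at key
  exact key.trans (by gcongr; exact h.norm_coe_le_norm s)

/-- The derivative is the superposition operator of `fderiv ℝ f` followed by a bounded linear map,
which gives an induction on the order. The codomain varies because the step passes from `F` to `E
→L[ℝ] F`. -/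
theorem contDiff_superposition_nat (n : ℕ) : ∀ {F : Type} [NormedAddCommGroup F] [NormedSpace ℝ F]
    {f : E → F} (hf : ContDiff ℝ ∞ f),
    ContDiff ℝ n (fun γ : C(K, E) => (ContinuousMap.mk f hf.continuous).comp γ) := by
  induction n with
  | zero =>
    intro F _ _ f hf
    exact contDiff_zero.2 (ContinuousMap.continuous_postcomp _)
  | succ n ih =>
    intro F _ _ f hf
    have h1 : ContDiff ℝ 1 f := hf.of_le (by norm_cast)
    have hd := hasFDerivAt_superposition (K := K) h1
    rw [Nat.cast_succ, contDiff_succ_iff_fderiv]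
    refine ⟨fun γ => (hd γ).differentiableAt, fun h => by simp at h, ?_⟩
    have : fderiv ℝ (fun γ : C(K, E) => (ContinuousMap.mk f hf.continuous).comp γ) = fun γ =>
        pointwiseApplyL K E F
        ((ContinuousMap.mk (fderiv ℝ f) (h1.continuous_fderiv one_ne_zero)).comp γ) :=
      funext fun γ => (hd γ).fderiv
    rw [this]
    exact (pointwiseApplyL K E F).contDiff.comp
      (ih (f := fderiv ℝ f) (hf.fderiv_right (by norm_cast)))

/-- The superposition operator `γ ↦ f ∘ γ` of a smooth map is smooth. -/
theorem contDiff_superposition {f : E → F} (hf : ContDiff ℝ ∞ f) :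
    ContDiff ℝ ∞ (fun γ : C(K, E) => (ContinuousMap.mk f hf.continuous).comp γ) :=
  contDiff_infty.2 fun n => contDiff_superposition_nat n hf

end Superposition

/-! ### Integrals depending on a parameter. -/

section Integration

variable {E F : Type} [NormedAddCommGroup E] [NormedSpace ℝ E] [NormedAddCommGroup F]
  [NormedSpace ℝ F]

/-- The primitive vanishing at `0` of a curve on the unit interval. -/
noncomputable def primitiveL (E : Type) [NormedAddCommGroup E] [NormedSpace ℝ E] :
    C(Icc (0 : ℝ) 1, E) →L[ℝ] C(Icc (0 : ℝ) 1, E) :=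
  LinearMap.mkContinuous
    { toFun := fun γ => ⟨fun s => ∫ r in (0 : ℝ)..s, γ (projIcc 0 1 zero_le_one r), by
        have h : Continuous fun r : ℝ => γ (projIcc 0 1 zero_le_one r) := by fun_prop
        exact (intervalIntegral.continuous_primitive (fun a b => h.intervalIntegrable a b) 0).comp
          continuous_subtype_val⟩
      map_add' := fun γ δ => by
        ext s
        have h (γ : C(Icc (0 : ℝ) 1, E)) :
          Continuous fun r : ℝ => γ (projIcc 0 1 zero_le_one r) := by fun_prop
        exact intervalIntegral.integral_add ((h γ).intervalIntegrable _ _)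
          ((h δ).intervalIntegrable _ _)
      map_smul' := fun c γ => by
        ext s
        exact intervalIntegral.integral_smul c _ } 1 (by
    intro γ
    rw [one_mul, ContinuousMap.norm_le _ (norm_nonneg _)]
    intro s
    refine (intervalIntegral.norm_integral_le_of_norm_le_const (C := ‖γ‖)
      fun r _ => γ.norm_coe_le_norm _).trans ?_
    have h0 := s.2.1
    have h1 := s.2.2
    rw [sub_zero, abs_of_nonneg h0]
    nlinarith [norm_nonneg γ])

theorem primitiveL_apply (γ : C(Icc (0 : ℝ) 1, E)) (s : Icc (0 : ℝ) 1) :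
    primitiveL E γ s = ∫ r in (0 : ℝ)..s, γ (projIcc 0 1 zero_le_one r) := rfl

/-- Integrals over the unit interval of a smooth map depend smoothly on parameters. -/
theorem contDiff_integral_unitInterval {f : ℝ × E → F} (hf : ContDiff ℝ ∞ f) :
    ContDiff ℝ ∞ fun x : E => ∫ t in (0 : ℝ)..1, f (t, x) := by
  -- The curve `s ↦ (s, x)` is `ι + κ x`, affine in `x`. The integral is the value at `1` of the
  -- primitive of its image under the superposition operator.
  let ι : C(Icc (0 : ℝ) 1, ℝ × E) := ⟨fun s => (s, 0), by fun_prop⟩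
  let κ : E →L[ℝ] C(Icc (0 : ℝ) 1, ℝ × E) :=
    (ContinuousLinearMap.compLeftContinuous ℝ (Icc (0 : ℝ) 1)
      (ContinuousLinearMap.inr ℝ ℝ E)).comp
      (constL (Icc (0 : ℝ) 1) E)
  have h1 : ContDiff ℝ ∞ fun x : E => primitiveL F
      ((ContinuousMap.mk f hf.continuous).comp (ι + κ x)) :=
    (primitiveL F).contDiff.comp ((contDiff_superposition hf).comp
      (contDiff_const.add κ.contDiff))
  have h2 := (ContinuousMap.evalCLM ℝ (⟨1, by simp⟩ : Icc (0 : ℝ) 1)).contDiff.comp h1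
  convert! h2 using 2 with x
  simp only [Function.comp_apply, ContinuousMap.evalCLM_apply, primitiveL_apply]
  refine intervalIntegral.integral_congr fun t ht => ?_
  rw [uIcc_of_le zero_le_one] at ht
  have : (ι + κ x) (projIcc 0 1 zero_le_one t) = (t, x) := by
    rw [projIcc_of_mem _ ht]
    change ((t, 0) : ℝ × E) + (0, x) = (t, x)
    simp
  simp only [ContinuousMap.comp_apply, this]
  rfl

end Integration

/-! ### Smooth dependence of solutions of differential equations, by the implicit function theorem.
-/

section LocalFlow

variable {E : Type} [NormedAddCommGroup E] [NormedSpace ℝ E] [CompleteSpace E]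

/-- Smooth dependence of the solutions of an ordinary differential equation on time and on the
initial condition, near time zero. -/
theorem contDiffAt_localFlow {f : E → E} (hf : ContDiff ℝ ∞ f) {φ : ℝ × E → E} {x₀ : E} {ε : ℝ}
    (hε : 0 < ε) (hφ : ∀ᶠ x in 𝓝 x₀, φ (0, x) = x ∧
      ∀ t ∈ Ioo (-ε) ε, HasDerivAt (fun t => φ (t, x)) (f (φ (t, x))) t)
    (hc : ContinuousAt φ (0, x₀)) : ContDiffAt ℝ ∞ φ (0, x₀) := by
  let C := C(Icc (0 : ℝ) 1, E)
  let const : E →L[ℝ] C := constL (Icc (0 : ℝ) 1) E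
  -- The zeros of `Φ ((t, x), ·)` are the solutions rescaled to unit time, `s ↦ φ (t * s, x)`. At `t
  -- = 0` the partial derivative in the curve is the identity, so these solutions depend smoothly on
  -- `(t, x)`.
  let Φ : (ℝ × E) × C → C := fun u => u.2 - const u.1.2 -
    u.1.1 • primitiveL E ((ContinuousMap.mk f hf.continuous).comp u.2)
  have hN : ContDiff ℝ ∞ fun u : (ℝ × E) × C =>
      primitiveL E ((ContinuousMap.mk f hf.continuous).comp u.2) :=
    (primitiveL E).contDiff.comp ((contDiff_superposition hf).comp contDiff_snd)
  have hΦ : ContDiff ℝ ∞ Φ := by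
    refine (contDiff_snd.sub (const.contDiff.comp (contDiff_snd.comp contDiff_fst))).sub ?_
    exact (contDiff_fst.comp contDiff_fst).smul hN
  let u₀ : (ℝ × E) × C := ((0, x₀), const x₀)
  have hpart : fderiv ℝ Φ u₀ ∘L .inr ℝ (ℝ × E) C = ContinuousLinearMap.id ℝ C := by
    have h1 : HasFDerivAt (fun γ : C => Φ ((0, x₀), γ))
        (fderiv ℝ Φ u₀ ∘L .inr ℝ (ℝ × E) C) (const x₀) :=
      ((hΦ.differentiable (by simp) u₀).hasFDerivAt).comp (const x₀)
        (hasFDerivAt_prodMk_right (0, x₀) (const x₀))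
    have h2 : HasFDerivAt (fun γ : C => Φ ((0, x₀), γ)) (ContinuousLinearMap.id ℝ C)
        (const x₀) := by
      have : (fun γ : C => Φ ((0, x₀), γ)) = fun γ => γ - const x₀ := by
        ext γ s
        simp [Φ]
      rw [this]
      exact (hasFDerivAt_id _).sub_const _
    exact h1.unique h2
  have hinv : (fderiv ℝ Φ u₀ ∘L .inr ℝ (ℝ × E) C).IsInvertible := by
    rw [hpart]
    exact ContinuousLinearMap.IsInvertible.of_inverse (g := ContinuousLinearMap.id ℝ C) rfl rfl
  have hat : ContDiffAt ℝ ∞ Φ u₀ := hΦ.contDiffAt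
  have hn : (∞ : ℕ∞ω) ≠ 0 := by simp
  have hsm := hat.contDiffAt_implicitFunction hn hinv
  have huniq := hat.eventually_apply_eq_iff_implicitFunction hn hinv
  have hu₀ : Φ u₀ = 0 := by
    ext s
    simp [Φ, u₀]
  have hev : ContDiffAt ℝ ∞ (fun v : ℝ × E => ContinuousMap.evalCLM ℝ
      (⟨1, by simp⟩ : Icc (0 : ℝ) 1) (hat.implicitFunction hn hinv v)) (0, x₀) :=
    (ContinuousLinearMap.contDiff _).contDiffAt.comp (0, x₀) hsm
  refine hev.congr_of_eventuallyEq ?_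
  rw [hu₀] at huniq
  obtain ⟨δ, hδ, hball⟩ := Metric.eventually_nhds_iff.1 huniq
  have hφ0 : φ (0, x₀) = x₀ := hφ.self_of_nhds.1
  -- The implicit function is the only zero within distance `δ`, so the rescaled orbit must be shown
  -- to stay that close to the constant curve. Half of `δ` is used because pointwise bounds give
  -- only a non-strict bound on the supremum.
  obtain ⟨η, hη, hη'⟩ := Metric.continuousAt_iff.1 hc (δ / 2) (by positivity)
  have e1 : ∀ᶠ v : ℝ × E in 𝓝 (0, x₀), dist v (0, x₀) < min (min η δ) ε :=
    Metric.ball_mem_nhds _ (by positivity)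
  have e2 : ∀ᶠ v : ℝ × E in 𝓝 (0, x₀), φ (0, v.2) = v.2 ∧
      ∀ t ∈ Ioo (-ε) ε, HasDerivAt (fun t => φ (t, v.2)) (f (φ (t, v.2))) t :=
    (continuous_snd.tendsto ((0 : ℝ), x₀)).eventually hφ
  filter_upwards [e1, e2] with ⟨t, x⟩ hd ⟨hx0, hx⟩
  simp only [lt_min_iff, Prod.dist_eq, max_lt_iff, Real.dist_eq, sub_zero] at hd
  obtain ⟨⟨⟨ht1, hx1⟩, ht2, hx2⟩, ht3, -⟩ := hd
  have hmem : ∀ s ∈ Icc (0 : ℝ) 1, |t * s| ≤ |t| := fun s hs => by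
    rw [abs_mul, abs_of_nonneg hs.1]
    exact mul_le_of_le_one_right (abs_nonneg _) hs.2
  have hder : ∀ s ∈ Icc (0 : ℝ) 1,
      HasDerivAt (fun s => φ (t * s, x)) (t • f (φ (t * s, x))) s := by
    intro s hs
    have hm : t * s ∈ Ioo (-ε) ε := abs_lt.1 ((hmem s hs).trans_lt ht3)
    have := (hx _ hm).scomp s ((hasDerivAt_id s).const_mul t)
    simpa [Function.comp_def] using this
  let γ : C := ⟨fun s => φ (t * s, x), by
    rw [continuous_iff_continuousAt]
    intro s
    exact ContinuousAt.comp (g := fun s : ℝ => φ (t * s, x)) (hder s s.2).continuousAt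
      continuous_subtype_val.continuousAt⟩
  have hγδ : dist γ (const x₀) < δ := by
    refine lt_of_le_of_lt ((ContinuousMap.dist_le (by positivity)).2 (fun s => ?_))
      (half_lt_self hδ)
    have := @hη' (t * s, x) (by
      simp only [Prod.dist_eq, max_lt_iff, Real.dist_eq, sub_zero]
      exact ⟨(hmem s s.2).trans_lt ht1, hx1⟩)
    rw [hφ0] at this
    exact this.le
  have hzero : Φ ((t, x), γ) = 0 := by
    ext s
    have hsub : ∀ r ∈ uIcc (0 : ℝ) s, r ∈ Icc (0 : ℝ) 1 := by
      intro r hr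
      rw [uIcc_of_le s.2.1] at hr
      exact ⟨hr.1, hr.2.trans s.2.2⟩
    have hint : ∫ r in (0 : ℝ)..s, t • f (φ (t * r, x)) = φ (t * s, x) - φ (t * 0, x) := by
      refine intervalIntegral.integral_eq_sub_of_hasDerivAt (fun r hr => hder r (hsub r hr)) ?_
      refine ContinuousOn.intervalIntegrable fun r hr => ContinuousAt.continuousWithinAt ?_
      exact ((hf.continuous.continuousAt).comp
        (hder r (hsub r hr)).continuousAt).const_smul t
    have hprim : primitiveL E ((ContinuousMap.mk f hf.continuous).comp γ) s =
        ∫ r in (0 : ℝ)..s, f (φ (t * r, x)) := by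
      rw [primitiveL_apply]
      refine intervalIntegral.integral_congr fun r hr => ?_
      simp only [projIcc_of_mem _ (hsub r hr)]
      rfl
    rw [intervalIntegral.integral_smul, mul_zero, hx0] at hint
    change γ s - x - t • primitiveL E ((ContinuousMap.mk f hf.continuous).comp γ) s = 0
    rw [hprim, hint]
    exact sub_self _
  have := (hball (y := ((t, x), γ)) (by
    simp only [u₀, Prod.dist_eq, max_lt_iff, Real.dist_eq, sub_zero]
    exact ⟨⟨ht2, hx2⟩, hγδ⟩)).1 hzero
  change φ (t, x) = hat.implicitFunction hn hinv (t, x) ⟨1, _⟩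
  rw [this]
  exact congrArg (fun r => φ (r, x)) (mul_one t).symm

end LocalFlow

/-! ### Localisation to open sets. -/

section Extension

variable {E F : Type} [NormedAddCommGroup E] [NormedSpace ℝ E] [FiniteDimensional ℝ E]
  [NormedAddCommGroup F] [NormedSpace ℝ F]

/-- A map which is smooth on `ℝ × U` agrees over a neighbourhood of any point of `U` with a smooth
map defined everywhere. -/
theorem exists_contDiff_eventually_eq {f : ℝ × E → F} {U : Set E} (hU : IsOpen U)
    (hf : ContDiffOn ℝ ∞ f (univ ×ˢ U)) {x₀ : E} (hx₀ : x₀ ∈ U) :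
    ∃ f' : ℝ × E → F, ContDiff ℝ ∞ f' ∧ ∀ᶠ x in 𝓝 x₀, ∀ t, f' (t, x) = f (t, x) := by
  obtain ⟨r, hr, hrU⟩ := Metric.nhds_basis_closedBall.mem_iff.1 (hU.mem_nhds hx₀)
  let χ : ContDiffBump x₀ := ⟨r / 2, r, by positivity, by linarith⟩
  refine ⟨fun p => χ p.2 • f p, ?_, ?_⟩
  · rw [contDiff_iff_contDiffAt]
    rintro ⟨t, x⟩
    by_cases hx : x ∈ U
    · exact ((χ.contDiff.comp contDiff_snd).contDiffAt).smul
        (hf.contDiffAt ((isOpen_univ.prod hU).mem_nhds ⟨mem_univ _, hx⟩))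
    · have h0 : (fun p : ℝ × E => χ p.2 • f p) =ᶠ[𝓝 (t, x)] fun _ => 0 := by
        have : x ∈ (tsupport χ)ᶜ := fun h => hx (hrU (by rwa [χ.tsupport_eq] at h))
        have := (isClosed_tsupport χ).isOpen_compl.mem_nhds this
        filter_upwards [continuous_snd.continuousAt.preimage_mem_nhds this] with p hp
        rw [image_eq_zero_of_notMem_tsupport hp, zero_smul]
      exact contDiffAt_const.congr_of_eventuallyEq h0
  · filter_upwards [χ.eventuallyEq_one] with x hx t
    simp [hx]

theorem contDiffOn_integral_unitInterval {f : ℝ × E → F} {U : Set E} (hU : IsOpen U)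
    (hf : ContDiffOn ℝ ∞ f (univ ×ˢ U)) :
    ContDiffOn ℝ ∞ (fun x : E => ∫ t in (0 : ℝ)..1, f (t, x)) U := by
  intro x₀ hx₀
  obtain ⟨f', hf', h⟩ := exists_contDiff_eventually_eq hU hf hx₀
  refine ((contDiff_integral_unitInterval hf').contDiffAt.congr_of_eventuallyEq
    ?_).contDiffWithinAt
  filter_upwards [h] with x hx
  exact intervalIntegral.integral_congr fun t _ => (hx t).symm

/-- Picard–Lindelöf gives a continuous local flow for a global smooth extension of `f`, and
`contDiffAt_localFlow` upgrades it to a smooth one. For short times the orbits stay where the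
extension agrees with `f`. -/
theorem exists_localFlow {f : E → E} {U : Set E} (hU : IsOpen U) (hf : ContDiffOn ℝ ∞ f U)
    {x₀ : E} (hx₀ : x₀ ∈ U) :
    ∃ φ : ℝ × E → E, ContDiffAt ℝ ∞ φ (0, x₀) ∧ ∃ ε > 0, ∀ᶠ x in 𝓝 x₀, φ (0, x) = x ∧
      ∀ t ∈ Ioo (-ε) ε, φ (t, x) ∈ U ∧ HasDerivAt (fun t => φ (t, x)) (f (φ (t, x))) t := by
  have : CompleteSpace E := FiniteDimensional.complete ℝ E
  obtain ⟨f', hf', h⟩ := exists_contDiff_eventually_eq (f := fun p : ℝ × E => f p.2) hU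
    (hf.comp contDiffOn_snd fun p hp => hp.2) hx₀
  let F : E → E := fun x => f' (0, x)
  have hF : ContDiff ℝ ∞ F := hf'.comp (contDiff_const.prodMk contDiff_id)
  have hFf : ∀ᶠ x in 𝓝 x₀, F x = f x ∧ x ∈ U := by
    filter_upwards [h, hU.mem_nhds hx₀] with x hx hxU
    exact ⟨hx 0, hxU⟩
  obtain ⟨ε, hε, a, r, L, K, hr, hpl⟩ := IsPicardLindelof.of_contDiffAt_one
    ((hF.of_le (by norm_cast)).contDiffAt (x := x₀))
  obtain ⟨α, hα, hαc⟩ := (hpl 0).exists_forall_mem_closedBall_eq_hasDerivWithinAt_continuousOn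
  simp only [zero_sub, zero_add] at hα hαc
  let φ : ℝ × E → E := fun p => α (p.2, p.1)
  have hball : Metric.closedBall x₀ r ∈ 𝓝 x₀ := Metric.closedBall_mem_nhds _ (by exact_mod_cast hr)
  have hIcc : Icc (-ε) ε ∈ 𝓝 (0 : ℝ) := Icc_mem_nhds (by linarith) hε
  have hc : ContinuousAt φ (0, x₀) :=
    ContinuousAt.comp (f := fun p : ℝ × E => (p.2, p.1)) (x := (0, x₀))
      (hαc.continuousAt (prod_mem_nhds hball hIcc)) (by fun_prop)
  have hφ : ∀ᶠ x in 𝓝 x₀, φ (0, x) = x ∧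
      ∀ t ∈ Ioo (-ε) ε, HasDerivAt (fun t => φ (t, x)) (F (φ (t, x))) t := by
    filter_upwards [hball] with x hx
    exact ⟨(hα x hx).1, fun t ht => ((hα x hx).2 t (Ioo_subset_Icc_self ht)).hasDerivAt
      (Icc_mem_nhds ht.1 ht.2)⟩
  refine ⟨φ, contDiffAt_localFlow hF hε hφ hc, ?_⟩
  have h0 : φ (0, x₀) = x₀ := hφ.self_of_nhds.1
  have hev : ∀ᶠ p : ℝ × E in 𝓝 (0, x₀), F (φ p) = f (φ p) ∧ φ p ∈ U :=
    hc.eventually (by rw [h0]; exact hFf)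
  rw [nhds_prod_eq, Filter.eventually_prod_iff] at hev
  obtain ⟨p, hp, q, hq, hpq⟩ := hev
  obtain ⟨δ, hδ, hδp⟩ := Metric.eventually_nhds_iff.1 hp
  refine ⟨min ε δ, by positivity, ?_⟩
  filter_upwards [hφ, hq] with x hx hqx
  refine ⟨hx.1, fun t ht => ?_⟩
  replace ht := lt_min_iff.1 (abs_lt.2 ht)
  have := hpq (hδp (y := t) (by simpa using ht.2)) hqx
  refine ⟨this.2, ?_⟩
  rw [← this.1]
  exact hx.2 t (abs_lt.1 ht.1)

end Extension

/-- A germ of finite order which is tangent to the identity is the identity. -/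
theorem eventually_eq_self_of_iterate_eq {E : Type*} [NormedAddCommGroup E] [NormedSpace ℝ E]
    [CompleteSpace E] {f : E → E} {x : E} {m : ℕ} (hm : m ≠ 0)
    (hf : HasStrictFDerivAt f (ContinuousLinearMap.id ℝ E) x) (hfx : f x = x)
    (hit : ∀ᶠ y in 𝓝 x, f^[m] y = y) : ∀ᶠ y in 𝓝 x, f y = y := by
  -- The sum over the iterates satisfies `h ∘ f = h` near `x`, because the `m`-th iterate is the
  -- identity. Its derivative is `m` times the identity, so `h` has a local left inverse, which
  -- forces `f y = y`.
  let h : E → E := fun y => ∑ k ∈ Finset.range m, f^[k] y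
  have hk : ∀ k, HasStrictFDerivAt (f^[k]) (ContinuousLinearMap.id ℝ E) x := by
    intro k
    have := hf.iterate hfx k
    rwa [show (ContinuousLinearMap.id ℝ E) ^ k = ContinuousLinearMap.id ℝ E from
      one_pow (M := E →L[ℝ] E) k] at this
  have hm' : (m : ℝ) ≠ 0 := by exact_mod_cast hm
  let e : E ≃L[ℝ] E := ContinuousLinearEquiv.smulLeft (Units.mk0 (m : ℝ) hm')
  have hh : HasStrictFDerivAt h (e : E →L[ℝ] E) x := by
    have := HasStrictFDerivAt.fun_sum (u := Finset.range m) fun k _ => hk k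
    convert! this using 1
    ext v
    simp [e, Units.smul_def, Nat.cast_smul_eq_nsmul]
  have hinv := hh.eventually_left_inverse
  have hft : Tendsto f (𝓝 x) (𝓝 x) := by
    have := hf.hasFDerivAt.continuousAt.tendsto
    rwa [hfx] at this
  filter_upwards [hinv, hft.eventually hinv, hit] with y h1 h2 h3
  have : h (f y) = h y := by
    simp only [h, ← Function.iterate_succ_apply]
    have := Finset.sum_range_succ (fun k => f^[k] y) m
    rw [Finset.sum_range_succ' (fun k => f^[k] y) m, h3] at this
    simpa using this
  rw [← h2, this, h1]

/-! ### Preferred charts and vector fields in them. -/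

section Charts

variable {m : ℕ} {M : Type*} [TopologicalSpace M] [ChartedSpace (Model m) M]
  [IsManifold (𝓡 m) ∞ M]

theorem contMDiffAt_extChartAt_symm {p : M} {y : Model m} (hy : y ∈ (extChartAt (𝓡 m) p).target) :
    ContMDiffAt 𝓘(ℝ, Model m) (𝓡 m) ∞ (extChartAt (𝓡 m) p).symm y :=
  (contMDiffOn_extChartAt_symm p).contMDiffAt ((isOpen_extChartAt_target p).mem_nhds hy)

theorem contMDiffAt_extChartAt_of_mem {p x : M} (hx : x ∈ (extChartAt (𝓡 m) p).source) :
    ContMDiffAt (𝓡 m) 𝓘(ℝ, Model m) ∞ (extChartAt (𝓡 m) p) x :=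
  contMDiffAt_extChartAt' (by rwa [extChartAt_source] at hx)

theorem mfderiv_extChartAt_mfderiv_symm {p : M} {y : Model m}
    (hy : y ∈ (extChartAt (𝓡 m) p).target) (v : Model m) :
    mfderiv (𝓡 m) 𝓘(ℝ, Model m) (extChartAt (𝓡 m) p) ((extChartAt (𝓡 m) p).symm y)
      (mfderiv 𝓘(ℝ, Model m) (𝓡 m) (extChartAt (𝓡 m) p).symm y v) = v := by
  have := IsManifold.of_le (I := 𝓡 m) (M := M) (m := 1) (n := ∞) (by norm_cast)
  have h := mfderiv_extChartAt_comp_mfderivWithin_extChartAt_symm (I := 𝓡 m) hy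
  rw [ModelWithCorners.range_eq_univ, mfderivWithin_univ] at h
  exact congrArg (fun L => L v) h

theorem mfderiv_symm_mfderiv_extChartAt {p x : M} (hx : x ∈ (extChartAt (𝓡 m) p).source)
    (v : Tan m x) :
    mfderiv 𝓘(ℝ, Model m) (𝓡 m) (extChartAt (𝓡 m) p).symm (extChartAt (𝓡 m) p x)
      (mfderiv (𝓡 m) 𝓘(ℝ, Model m) (extChartAt (𝓡 m) p) x v) = v := by
  have := IsManifold.of_le (I := 𝓡 m) (M := M) (m := 1) (n := ∞) (by norm_cast)
  have h := mfderivWithin_extChartAt_symm_comp_mfderiv_extChartAt' (I := 𝓡 m) hx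
  rw [ModelWithCorners.range_eq_univ, mfderivWithin_univ] at h
  exact congrArg (fun L => L v) h

/-- The expression of a vector field in the preferred chart around `p`. -/
noncomputable def chartField (p : M) (X : ∀ x : M, Tan m x) (y : Model m) : Model m :=
  mfderiv (𝓡 m) 𝓘(ℝ, Model m) (extChartAt (𝓡 m) p) ((extChartAt (𝓡 m) p).symm y)
    (X ((extChartAt (𝓡 m) p).symm y))

theorem mfderiv_symm_chartField {p : M} {X : ∀ x : M, Tan m x} {y : Model m}
    (hy : y ∈ (extChartAt (𝓡 m) p).target) :
    mfderiv 𝓘(ℝ, Model m) (𝓡 m) (extChartAt (𝓡 m) p).symm y (chartField p X y) =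
      X ((extChartAt (𝓡 m) p).symm y) := by
  have h := mfderiv_symm_mfderiv_extChartAt ((extChartAt (𝓡 m) p).map_target hy)
    (X ((extChartAt (𝓡 m) p).symm y))
  rw [(extChartAt (𝓡 m) p).right_inv hy] at h
  exact h

theorem IsSmoothField.contDiffOn_chartField {X : ∀ x : M, Tan m x} (hX : IsSmoothField X) (p : M) :
    ContDiffOn ℝ ∞ (chartField p X) (extChartAt (𝓡 m) p).target := by
  have := IsManifold.of_le (I := 𝓡 m) (M := M) (m := 1) (n := ∞) (by norm_cast)
  let e := trivializationAt (Model m) (TangentSpace (𝓡 m) : M → Type _) p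
  have h1 := (e.contMDiffOn_section_baseSet_iff (IB := 𝓡 m) (n := ∞) (s := X)).1
    (ContMDiff.contMDiffOn hX)
  rw [TangentBundle.trivializationAt_baseSet, ← extChartAt_source (𝓡 m)] at h1
  have h2 := h1.comp (contMDiffOn_extChartAt_symm p) (extChartAt (𝓡 m) p).mapsTo_symm
  rw [contMDiffOn_iff_contDiffOn] at h2
  refine h2.congr fun y hy => ?_
  have hx := (extChartAt (𝓡 m) p).map_target hy
  rw [extChartAt_source] at hx
  rw [chartField, ← TangentBundle.continuousLinearMapAt_trivializationAt hx]
  exact e.continuousLinearMapAt_apply_of_mem (R := ℝ) hx _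

end Charts

/-- `φ` is the (complete, smooth) flow of the vector field `X`. -/
structure IsFlow {m : ℕ} {M : Type*} [TopologicalSpace M] [ChartedSpace (Model m) M]
    (X : ∀ x : M, Tan m x) (φ : ℝ → M → M) : Prop where
  smooth : ContMDiff (𝓘(ℝ, ℝ).prod (𝓡 m)) (𝓡 m) ∞ (fun p : ℝ × M => φ p.1 p.2)
  zero : ∀ x, φ 0 x = x
  add : ∀ s t x, φ (s + t) x = φ s (φ t x)
  curve : ∀ x, IsMIntegralCurve (I := 𝓡 m) (fun t => φ t x) X

/-- On a compact space, a property which holds locally for small positive `δ` holds everywhere for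
some positive `δ`. -/
theorem exists_pos_forall_of_eventually {M : Type*} [TopologicalSpace M] [CompactSpace M]
    {P : ℝ → M → Prop} (hP : ∀ δ ε x, δ ≤ ε → P ε x → P δ x)
    (h : ∀ p, ∃ ε > 0, ∀ᶠ x in 𝓝 p, P ε x) : ∃ δ > 0, ∀ x, P δ x := by
  have key : ∃ δ > 0, ∀ x ∈ univ, P δ x := by
    refine isCompact_univ.induction_on (p := fun s => ∃ δ > 0, ∀ x ∈ s, P δ x)
      ⟨1, one_pos, by simp⟩ (fun s t hst ⟨δ, hδ, ht⟩ => ⟨δ, hδ, fun x hx => ht x (hst hx)⟩) ?_ ?_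
    · rintro s t ⟨δ, hδ, hs⟩ ⟨ε, hε, ht⟩
      refine ⟨min δ ε, lt_min hδ hε, fun x hx => ?_⟩
      rcases hx with hx | hx
      · exact hP _ _ _ (min_le_left _ _) (hs x hx)
      · exact hP _ _ _ (min_le_right _ _) (ht x hx)
    · intro p _
      obtain ⟨ε, hε, hp⟩ := h p
      exact ⟨_, mem_nhdsWithin_of_mem_nhds hp, ε, hε, fun x hx => hx⟩
  obtain ⟨δ, hδ, h⟩ := key
  exact ⟨δ, hδ, fun x => h x (mem_univ x)⟩

/-! ### The global smooth flow on a compact manifold. -/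

section Flow

variable {m : ℕ} {M : Type*} [TopologicalSpace M] [ChartedSpace (Model m) M]
  [IsManifold (𝓡 m) ∞ M]

theorem exists_localFlow_manifold {X : ∀ x : M, Tan m x} (hX : IsSmoothField X) (p : M) :
    ∃ Φ : ℝ × M → M, ContMDiffAt (𝓘(ℝ, ℝ).prod (𝓡 m)) (𝓡 m) ∞ Φ (0, p) ∧
      ∃ ε > 0, ∀ᶠ x in 𝓝 p, Φ (0, x) = x ∧
        IsMIntegralCurveOn (I := 𝓡 m) (fun t => Φ (t, x)) X (Ioo (-ε) ε) := by
  have hp := mem_extChartAt_source (I := 𝓡 m) p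
  obtain ⟨φ, hφ, ε, hε, h⟩ := exists_localFlow (isOpen_extChartAt_target (I := 𝓡 m) p)
    (hX.contDiffOn_chartField p) (mem_extChartAt_target (I := 𝓡 m) p)
  refine ⟨fun q => (extChartAt (𝓡 m) p).symm (φ (q.1, extChartAt (𝓡 m) p q.2)), ?_, ε, hε, ?_⟩
  · have h0 : φ (0, extChartAt (𝓡 m) p p) = extChartAt (𝓡 m) p p := h.self_of_nhds.1
    have h1 : ContMDiffAt (𝓘(ℝ, ℝ).prod (𝓡 m)) 𝓘(ℝ, ℝ × Model m) ∞
        (fun q : ℝ × M => (q.1, extChartAt (𝓡 m) p q.2)) (0, p) :=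
      contMDiffAt_fst.prodMk_space ((contMDiffAt_extChartAt_of_mem hp).comp (0, p) contMDiffAt_snd)
    have h2 := (contMDiffAt_iff_contDiffAt.2 hφ).comp (0, p) h1
    refine ContMDiffAt.comp (0, p) (contMDiffAt_extChartAt_symm ?_) h2
    simp only [h0]
    exact mem_extChartAt_target p
  · filter_upwards [(continuousAt_extChartAt (I := 𝓡 m) p).eventually h,
      (isOpen_extChartAt_source p).mem_nhds hp] with x hx hxs
    refine ⟨by simp only [hx.1, (extChartAt (𝓡 m) p).left_inv hxs], fun t ht => ?_⟩
    obtain ⟨hm, hd⟩ := hx.2 t ht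
    refine HasMFDerivAt.hasMFDerivWithinAt ?_
    have h1 := ((contMDiffAt_extChartAt_symm hm).mdifferentiableAt (by simp)).hasMFDerivAt.comp t
      hd.hasFDerivAt.hasMFDerivAt
    refine h1.congr_mfderiv ?_
    refine ContinuousLinearMap.ext_ring ?_
    change mfderiv 𝓘(ℝ, Model m) (𝓡 m) (extChartAt (𝓡 m) p).symm _
      ((1 : ℝ) • chartField p X _) = (1 : ℝ) • X _
    rw [one_smul, one_smul]
    exact mfderiv_symm_chartField hm

variable [T2Space M] [CompactSpace M]

/-- Compactness makes the local existence time uniform, so integral curves extend to all times.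
Smoothness near time zero, again uniform in the point, reaches every time through the group law, in
small steps. -/
theorem exists_flow {X : ∀ x : M, Tan m x} (hX : IsSmoothField X) : ∃ φ, IsFlow X φ := by
  have := IsManifold.of_le (I := 𝓡 m) (M := M) (m := 1) (n := ∞) (by norm_cast)
  have hX1 : ContMDiff (𝓡 m) (𝓡 m).tangent 1 (fun x => (⟨x, X x⟩ : TangentBundle (𝓡 m) M)) :=
    ContMDiff.of_le hX (by norm_cast)
  choose Φ hΦ ε hε hloc using exists_localFlow_manifold hX
  obtain ⟨δ, hδ, hδl⟩ := exists_pos_forall_of_eventually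
    (P := fun δ x => ∃ γ : ℝ → M, γ 0 = x ∧
      IsMIntegralCurveOn (I := 𝓡 m) γ X (Ioo (-δ) δ))
    (fun δ ε x h ⟨γ, h0, hγ⟩ => ⟨γ, h0, hγ.mono (Ioo_subset_Ioo (neg_le_neg h) h)⟩)
    fun p => ⟨ε p, hε p, (hloc p).mono fun x hx => ⟨fun t => Φ p (t, x), hx⟩⟩
  have hgl : ∀ x : M, ∃ γ : ℝ → M, γ 0 = x ∧ IsMIntegralCurve (I := 𝓡 m) γ X := by
    exact exists_isMIntegralCurve_of_isMIntegralCurveOn hX1 hδ hδl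
  choose γ hγ0 hγ using hgl
  have hadd : ∀ s t x, γ x (s + t) = γ (γ x t) s := by
    intro s t x
    have := isMIntegralCurve_Ioo_eq_of_contMDiff_boundaryless (t₀ := 0) hX1
      ((hγ x).comp_add t) (hγ (γ x t)) (by simp [hγ0])
    exact congrFun this s
  have hloc0 : ∀ p, ContMDiffAt (𝓘(ℝ, ℝ).prod (𝓡 m)) (𝓡 m) ∞
      (fun q : ℝ × M => γ q.2 q.1) (0, p) := by
    intro p
    refine (hΦ p).congr_of_eventuallyEq ?_
    have e1 : ∀ᶠ q : ℝ × M in 𝓝 (0, p), q.1 ∈ Ioo (-ε p) (ε p) :=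
      continuous_fst.continuousAt.preimage_mem_nhds
        (Ioo_mem_nhds (neg_lt_zero.2 (hε p)) (hε p))
    have e2 := (continuous_snd.tendsto ((0 : ℝ), p)).eventually (hloc p)
    filter_upwards [e1, e2] with ⟨t, x⟩ ht hx
    exact isMIntegralCurveOn_Ioo_eqOn_of_contMDiff_boundaryless
      ⟨neg_lt_zero.2 (hε p), hε p⟩ hX1 ((hγ x).isMIntegralCurveOn _) hx.2
      (by simp only [hγ0, hx.1]) ht
  refine ⟨fun t x => γ x t, ?_, hγ0, hadd, hγ⟩
  -- Differentiability at a point spreads to a neighbourhood only for finite order, so the orders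
  -- are treated one at a time, with a time `δ` that may depend on `n`.
  rw [contMDiff_infty]
  intro n
  have hopen : ∀ p, ∃ η > 0, ∀ᶠ x in 𝓝 p, ∀ t, |t| < η →
      ContMDiffAt (𝓘(ℝ, ℝ).prod (𝓡 m)) (𝓡 m) n (fun q : ℝ × M => γ q.2 q.1) (t, x) := by
    intro p
    have := IsManifold.of_le (I := 𝓡 m) (M := M) (m := n) (n := ∞) (by norm_cast; exact le_top)
    have := (contMDiffAt_iff_contMDiffAt_nhds (by simp)).1
      ((hloc0 p).of_le (m := n) (by norm_cast; exact le_top))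
    rw [nhds_prod_eq, Filter.eventually_prod_iff] at this
    obtain ⟨P, hP, Q, hQ, h⟩ := this
    obtain ⟨η, hη, hηP⟩ := Metric.eventually_nhds_iff.1 hP
    exact ⟨η, hη, hQ.mono fun x hx t ht => h (hηP (by simpa using ht)) hx⟩
  obtain ⟨δ, hδ, hsmall⟩ := exists_pos_forall_of_eventually
    (P := fun δ x => ∀ t, |t| < δ →
      ContMDiffAt (𝓘(ℝ, ℝ).prod (𝓡 m)) (𝓡 m) n (fun q : ℝ × M => γ q.2 q.1) (t, x))
    (fun δ ε x h H t ht => H t (ht.trans_le h)) hopen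
  have hstep : ∀ t r, |r| < δ → (∀ x, ContMDiffAt (𝓘(ℝ, ℝ).prod (𝓡 m)) (𝓡 m) n
      (fun q : ℝ × M => γ q.2 q.1) (t, x)) → ∀ x, ContMDiffAt (𝓘(ℝ, ℝ).prod (𝓡 m)) (𝓡 m) n
      (fun q : ℝ × M => γ q.2 q.1) (r + t, x) := by
    intro t r hr ht x
    have h1 : ContMDiffAt (𝓘(ℝ, ℝ).prod (𝓡 m)) (𝓡 m) n (fun q : ℝ × M => γ q.2 t) (r + t, x) :=
      ContMDiffAt.comp (r + t, x) (g := fun q : ℝ × M => γ q.2 q.1)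
        (f := fun q : ℝ × M => (t, q.2)) (ht x) (contMDiffAt_const.prodMk contMDiffAt_snd)
    have h2 : ContMDiffAt (𝓘(ℝ, ℝ).prod (𝓡 m)) 𝓘(ℝ, ℝ) n (fun q : ℝ × M => q.1 - t)
        (r + t, x) := contMDiffAt_fst.sub contMDiffAt_const
    have h3 := ContMDiffAt.comp (r + t, x) (g := fun q : ℝ × M => γ q.2 q.1)
      (f := fun q : ℝ × M => (q.1 - t, γ q.2 t)) (by
        rw [add_sub_cancel_right]; exact hsmall _ r hr) (h2.prodMk h1)
    convert! h3 using 1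
    funext q
    simp only [Function.comp_apply, ← hadd, sub_add_cancel]
  rintro ⟨t, x⟩
  obtain ⟨k, hk⟩ := exists_nat_gt (|t| / δ)
  have hk0 : (0 : ℝ) < k := lt_of_le_of_lt (by positivity) hk
  have hr : |t / k| < δ := by
    rw [abs_div, abs_of_pos hk0, div_lt_iff₀ hk0]
    rwa [div_lt_iff₀ hδ, mul_comm] at hk
  have hall : ∀ j : ℕ, ∀ x, ContMDiffAt (𝓘(ℝ, ℝ).prod (𝓡 m)) (𝓡 m) n
      (fun q : ℝ × M => γ q.2 q.1) (j * (t / k), x) := by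
    intro j
    induction j with
    | zero => intro x; exact hsmall _ _ (by simpa using hδ)
    | succ j ih =>
      intro x
      have := hstep _ _ hr ih x
      rwa [show t / k + j * (t / k) = ((j + 1 : ℕ) : ℝ) * (t / k) by push_cast; ring] at this
  have := hall k x
  rwa [mul_div_cancel₀ _ hk0.ne'] at this

end Flow

/-! ### Return times and germs of periods. -/

section Periods

variable {m : ℕ} {M : Type*} [TopologicalSpace M] [ChartedSpace (Model m) M]
  {X : ∀ x : M, Tan m x} {φ : ℝ → M → M}

theorem IsFlow.continuous (hφ : IsFlow X φ) : Continuous fun q : ℝ × M => φ q.1 q.2 :=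
  hφ.smooth.continuous

theorem IsFlow.neg_apply (hφ : IsFlow X φ) (t : ℝ) (x : M) : φ (-t) (φ t x) = x := by
  rw [← hφ.add, neg_add_cancel, hφ.zero]

theorem IsFlow.comm (hφ : IsFlow X φ) (s t : ℝ) (x : M) : φ s (φ t x) = φ t (φ s x) := by
  rw [← hφ.add, ← hφ.add, add_comm]

/-- The group of periods of a point under a flow. -/
def IsFlow.periods (hφ : IsFlow X φ) (x : M) : AddSubgroup ℝ where
  carrier := {t | φ t x = x}
  add_mem' {s t} hs ht := by
    simp only [mem_ofPred_eq] at *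
    rw [hφ.add, ht, hs]
  zero_mem' := hφ.zero x
  neg_mem' {t} ht := by
    simp only [mem_ofPred_eq] at *
    have := hφ.neg_apply t x
    rwa [ht] at this

theorem IsFlow.mem_periods (hφ : IsFlow X φ) {x : M} {t : ℝ} : t ∈ hφ.periods x ↔ φ t x = x :=
  Iff.rfl

theorem IsFlow.periods_apply (hφ : IsFlow X φ) (t : ℝ) (x : M) :
    hφ.periods (φ t x) = hφ.periods x := by
  ext s
  rw [hφ.mem_periods, hφ.mem_periods, hφ.comm]
  refine ⟨fun h => ?_, fun h => by rw [h]⟩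
  rw [← hφ.neg_apply t (φ s x), h, hφ.neg_apply]

theorem IsFlow.continuous_apply (hφ : IsFlow X φ) (t : ℝ) : Continuous (φ t) :=
  hφ.continuous.comp (Continuous.prodMk_right t)

/-- The function `s` is continuous at `p`, and its values near `p` are periods. -/
structure IsPeriodGerm (φ : ℝ → M → M) (s : M → ℝ) (p : M) : Prop where
  continuousAt : ContinuousAt s p
  eventually : ∀ᶠ x in 𝓝 p, φ (s x) x = x

/-- The group of values at `x` of germs of continuous functions whose values are periods. -/
def IsFlow.germPeriods (hφ : IsFlow X φ) (x : M) : AddSubgroup ℝ where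
  carrier := {t | ∃ s, IsPeriodGerm φ s x ∧ s x = t}
  add_mem' := by
    rintro _ _ ⟨s, hs, rfl⟩ ⟨s', hs', rfl⟩
    refine ⟨s + s', ⟨hs.continuousAt.add hs'.continuousAt, ?_⟩, rfl⟩
    filter_upwards [hs.eventually, hs'.eventually] with y h1 h2
    exact (hφ.periods y).add_mem h1 h2
  zero_mem' := ⟨0, ⟨continuousAt_const, Eventually.of_forall hφ.zero⟩, rfl⟩
  neg_mem' := by
    rintro _ ⟨s, hs, rfl⟩
    refine ⟨-s, ⟨hs.continuousAt.neg, ?_⟩, rfl⟩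
    filter_upwards [hs.eventually] with y h1
    exact (hφ.periods y).neg_mem h1

theorem IsFlow.germPeriods_le (hφ : IsFlow X φ) (x : M) : hφ.germPeriods x ≤ hφ.periods x := by
  rintro _ ⟨s, hs, rfl⟩
  exact hs.eventually.self_of_nhds

theorem IsFlow.germPeriods_le_apply (hφ : IsFlow X φ) (t : ℝ) (x : M) :
    hφ.germPeriods x ≤ hφ.germPeriods (φ t x) := by
  rintro _ ⟨s, hs, rfl⟩
  have hc : Tendsto (φ (-t)) (𝓝 (φ t x)) (𝓝 x) := by
    have := (hφ.continuous_apply (-t)).tendsto (φ t x)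
    rwa [hφ.neg_apply] at this
  refine ⟨fun y => s (φ (-t) y), ⟨?_, ?_⟩, by simp only [hφ.neg_apply]⟩
  · refine ContinuousAt.comp (g := s) ?_ (hφ.continuous_apply (-t)).continuousAt
    rw [hφ.neg_apply]
    exact hs.continuousAt
  · filter_upwards [hc.eventually hs.eventually] with y hy
    rw [← hφ.mem_periods, hφ.periods_apply] at hy
    exact hy

theorem IsFlow.germPeriods_apply (hφ : IsFlow X φ) (t : ℝ) (x : M) :
    hφ.germPeriods (φ t x) = hφ.germPeriods x := by
  refine le_antisymm ?_ (hφ.germPeriods_le_apply t x)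
  have := hφ.germPeriods_le_apply (-t) (φ t x)
  rwa [hφ.neg_apply] at this

variable [IsManifold (𝓡 m) ∞ M]

theorem contDiffAt_chart_of_contMDiffAt {f : ℝ × M → M} {p q : M} {t : ℝ}
    (hf : ContMDiffAt (𝓘(ℝ, ℝ).prod (𝓡 m)) (𝓡 m) ∞ f (t, p))
    (hq : f (t, p) ∈ (extChartAt (𝓡 m) q).source) :
    ContDiffAt ℝ ∞ (fun z : ℝ × Model m =>
      extChartAt (𝓡 m) q (f (z.1, (extChartAt (𝓡 m) p).symm z.2))) (t, extChartAt (𝓡 m) p p) := by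
  have h0 : (extChartAt (𝓡 m) p).symm (extChartAt (𝓡 m) p p) = p := extChartAt_to_inv p
  have h1 : ContMDiffAt 𝓘(ℝ, ℝ × Model m) (𝓘(ℝ, ℝ).prod (𝓡 m)) ∞
      (fun z : ℝ × Model m => (z.1, (extChartAt (𝓡 m) p).symm z.2)) (t, extChartAt (𝓡 m) p p) := by
    rw [modelWithCornersSelf_prod, ← chartedSpaceSelf_prod]
    exact contMDiffAt_fst.prodMk
      ((contMDiffAt_extChartAt_symm (mem_extChartAt_target p)).comp (t, extChartAt (𝓡 m) p p)
        contMDiffAt_snd)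
  rw [← contMDiffAt_iff_contDiffAt]
  have h2 : ContMDiffAt (𝓘(ℝ, ℝ).prod (𝓡 m)) 𝓘(ℝ, Model m) ∞
      (fun z : ℝ × M => extChartAt (𝓡 m) q (f z))
      (t, (extChartAt (𝓡 m) p).symm (extChartAt (𝓡 m) p p)) := by
    rw [h0]
    exact (contMDiffAt_extChartAt_of_mem hq).comp (t, p) hf
  exact ContMDiffAt.comp (g := fun z : ℝ × M => extChartAt (𝓡 m) q (f z))
    (f := fun z : ℝ × Model m => (z.1, (extChartAt (𝓡 m) p).symm z.2))
    (t, extChartAt (𝓡 m) p p) h2 h1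

/-- Near a periodic point, the return times close to a given period are values of a smooth
function. -/
theorem IsFlow.exists_return_time (hφ : IsFlow X φ) {p : M} (hp : X p ≠ 0) {σ : ℝ}
    (hσ : φ σ p = p) : ∃ r : M → ℝ, ContMDiffAt (𝓡 m) 𝓘(ℝ, ℝ) ∞ r p ∧ r p = σ ∧
      ∀ᶠ q : ℝ × M in 𝓝 (σ, p), φ q.1 q.2 = q.2 → q.1 = r q.2 := by
  have hps := mem_extChartAt_source (I := 𝓡 m) p
  let κ := extChartAt (𝓡 m) p
  let v : Model m := mfderiv (𝓡 m) 𝓘(ℝ, Model m) κ p (X p)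
  have hv : v ≠ 0 := by
    intro hv
    apply hp
    rw [← mfderiv_symm_mfderiv_extChartAt hps (X p)]
    exact (congrArg _ hv).trans (map_zero _)
  let l : Model m →L[ℝ] ℝ := innerSL ℝ v
  have hlv : l v ≠ 0 := by simpa [l] using hv
  let Ψ : Model m × ℝ → Model m := fun z => κ (φ z.2 (κ.symm z.1))
  have hΨ : ContDiffAt ℝ ∞ Ψ (κ p, σ) := by
    have := contDiffAt_chart_of_contMDiffAt (f := fun q : ℝ × M => φ q.1 q.2) (q := p)
      (hφ.smooth (σ, p)) (by rw [hσ]; exact hps)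
    exact ContDiffAt.comp (f := fun z : Model m × ℝ => (z.2, z.1)) (κ p, σ) this
      (contDiffAt_snd.prodMk contDiffAt_fst)
  -- `F` is the displacement along `v`, the velocity at `p`. It vanishes whenever `φ t x = x`, and
  -- its time derivative at `(p, σ)` is `⟪v, v⟫ ≠ 0`, so the implicit function theorem solves for
  -- the time.
  let F : Model m × ℝ → ℝ := fun z => l (Ψ z) - l z.1
  have hF : ContDiffAt ℝ ∞ F (κ p, σ) :=
    (l.contDiff.contDiffAt.comp _ hΨ).sub (l.contDiff.contDiffAt.comp _ contDiffAt_fst)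
  have hκp : κ.symm (κ p) = p := extChartAt_to_inv p
  have hF0 : F (κ p, σ) = 0 := by simp only [F, Ψ, hκp, hσ, sub_self]
  have hcurve : HasDerivAt (fun t => F (κ p, t)) (l v) σ := by
    have h1 := (hφ.curve p σ)
    have h2 : HasMFDerivAt (𝓡 m) 𝓘(ℝ, Model m) κ (φ σ p)
        (mfderiv (𝓡 m) 𝓘(ℝ, Model m) κ (φ σ p)) :=
      ((contMDiffAt_extChartAt_of_mem (by rw [hσ]; exact hps)).mdifferentiableAt
        (by simp)).hasMFDerivAt
    have h3 : HasFDerivAt (fun t => κ (φ t p) : ℝ → Model m)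
      (ContinuousLinearMap.toSpanSingleton ℝ v) σ := by
      refine ((h2.comp σ h1).congr_mfderiv ?_).hasFDerivAt
      refine ContinuousLinearMap.ext_ring ?_
      change mfderiv (𝓡 m) 𝓘(ℝ, Model m) κ (φ σ p) ((1 : ℝ) • X (φ σ p)) = (1 : ℝ) • v
      rw [one_smul, one_smul, hσ]
    have h4 := (l.hasFDerivAt.comp_hasDerivAt σ h3.hasDerivAt).sub_const (l (κ p))
    convert! h4 using 1
    · funext t
      simp only [F, Ψ, hκp, Function.comp_apply]
    · simp
  have hpart : fderiv ℝ F (κ p, σ) ∘L .inr ℝ (Model m) ℝ =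
      ContinuousLinearMap.toSpanSingleton ℝ (l v) :=
    (((hF.differentiableAt (by simp)).hasFDerivAt).comp σ
      (hasFDerivAt_prodMk_right (κ p) σ)).unique hcurve.hasFDerivAt
  have hinv : (fderiv ℝ F (κ p, σ) ∘L .inr ℝ (Model m) ℝ).IsInvertible := by
    rw [hpart]
    refine ContinuousLinearMap.IsInvertible.of_inverse
      (g := ContinuousLinearMap.toSpanSingleton ℝ (l v)⁻¹) ?_ ?_ <;>
    · ext
      simp [hlv]
  have hn : (∞ : ℕ∞ω) ≠ 0 := by simp
  refine ⟨fun x => hF.implicitFunction hn hinv (κ x), ?_, hF.implicitFunction_apply_self hn hinv,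
    ?_⟩
  · exact ContMDiffAt.comp (I' := 𝓘(ℝ, Model m)) p
      (contMDiffAt_iff_contDiffAt.2 (hF.contDiffAt_implicitFunction hn hinv))
      (contMDiffAt_extChartAt_of_mem hps)
  · have hc : ContinuousAt (fun q : ℝ × M => (κ q.2, q.1)) (σ, p) :=
      (ContinuousAt.comp (f := Prod.snd) (x := (σ, p)) (continuousAt_extChartAt p)
        continuousAt_snd).prodMk continuousAt_fst
    have e1 := hc.eventually (hF.eventually_apply_eq_iff_implicitFunction hn hinv)
    have e2 : ∀ᶠ q : ℝ × M in 𝓝 (σ, p), q.2 ∈ κ.source :=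
      continuous_snd.continuousAt.preimage_mem_nhds ((isOpen_extChartAt_source p).mem_nhds hps)
    filter_upwards [e1, e2] with q h1 h2 h3
    refine (h1.1 ?_).symm
    rw [hF0]
    simp only [F, Ψ]
    rw [κ.left_inv h2, h3, sub_self]

/-- Time zero is always a return time, so the local return time function at `σ = 0` vanishes near
`p`, and it captures all small periods. -/
theorem IsFlow.eventually_period_eq_zero (hφ : IsFlow X φ) {p : M} (hp : X p ≠ 0) :
    ∀ᶠ q : ℝ × M in 𝓝 (0, p), φ q.1 q.2 = q.2 → q.1 = 0 := by
  obtain ⟨r, -, -, h⟩ := hφ.exists_return_time hp (hφ.zero p)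
  have h0 : ∀ᶠ q : ℝ × M in 𝓝 (0, p), 0 = r q.2 := by
    have hc : ContinuousAt (fun q : ℝ × M => ((0 : ℝ), q.2)) (0, p) := by fun_prop
    filter_upwards [hc.eventually h] with q hq
    exact hq (hφ.zero _)
  filter_upwards [h, h0] with q h1 h2 h3
  rw [h1 h3, ← h2]

theorem IsFlow.exists_lower_bound_periods (hφ : IsFlow X φ) {p : M} (hp : X p ≠ 0) :
    ∃ a > 0, ∀ᶠ x in 𝓝 p, ∀ t, 0 < t → φ t x = x → a ≤ t := by
  have := hφ.eventually_period_eq_zero hp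
  rw [nhds_prod_eq, Filter.eventually_prod_iff] at this
  obtain ⟨P, hP, Q, hQ, h⟩ := this
  obtain ⟨a, ha, haP⟩ := Metric.eventually_nhds_iff.1 hP
  refine ⟨a, ha, hQ.mono fun x hx t ht htx => ?_⟩
  by_contra hlt
  exact ht.ne' (h (haP (y := t) (by rw [Real.dist_eq, sub_zero, abs_of_pos ht]; exact not_le.1 hlt))
    hx htx)

variable {s s' : M → ℝ} {p : M}

/-- Both germs coincide near `p` with the return time function belonging to their common value. -/
theorem IsPeriodGerm.eventuallyEq (hφ : IsFlow X φ) (hp : X p ≠ 0) (hs : IsPeriodGerm φ s p)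
    (hs' : IsPeriodGerm φ s' p) (h : s p = s' p) : s =ᶠ[𝓝 p] s' := by
  obtain ⟨r, -, -, hr⟩ := hφ.exists_return_time hp hs.eventually.self_of_nhds
  have h1 : ContinuousAt (fun x => (s x, x)) p := hs.continuousAt.prodMk continuousAt_id
  have h2 : ContinuousAt (fun x => (s' x, x)) p := hs'.continuousAt.prodMk continuousAt_id
  filter_upwards [h1.eventually hr, h2.eventually (h ▸ hr), hs.eventually, hs'.eventually]
    with x h3 h4 h5 h6
  exact (h3 h5).trans (h4 h6).symm

theorem IsPeriodGerm.contMDiffAt (hφ : IsFlow X φ) (hp : X p ≠ 0) (hs : IsPeriodGerm φ s p) :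
    ContMDiffAt (𝓡 m) 𝓘(ℝ, ℝ) ∞ s p := by
  obtain ⟨r, hr1, -, hr⟩ := hφ.exists_return_time hp hs.eventually.self_of_nhds
  have h1 : ContinuousAt (fun x => (s x, x)) p := hs.continuousAt.prodMk continuousAt_id
  refine hr1.congr_of_eventuallyEq ?_
  filter_upwards [h1.eventually hr, hs.eventually] with x h2 h3
  exact h2 h3

theorem IsPeriodGerm.eventually_isPeriodGerm (hφ : IsFlow X φ) (hp : X p ≠ 0)
    (hs : IsPeriodGerm φ s p) : ∀ᶠ x in 𝓝 p, IsPeriodGerm φ s x := by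
  have := IsManifold.of_le (I := 𝓡 m) (M := M) (m := 1) (n := ∞) (by norm_cast)
  have h1 := (contMDiffAt_iff_contMDiffAt_nhds (n := 1) (by simp)).1
    ((hs.contMDiffAt hφ hp).of_le (by norm_cast))
  filter_upwards [h1, hs.eventually.eventually_nhds] with x h2 h3
  exact ⟨h2.continuousAt, h3⟩

/-- Positive periods are bounded away from zero at a point where `X` does not vanish, so the group
is discrete. -/
theorem IsFlow.exists_isLeast_of_le_periods (hφ : IsFlow X φ) (hp : X p ≠ 0) {G : AddSubgroup ℝ}
    (hG : G ≤ hφ.periods p) (h : ∃ t ∈ G, 0 < t) : ∃ T, IsLeast {t : ℝ | t ∈ G ∧ 0 < t} T := by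
  obtain ⟨a, ha, h1⟩ := hφ.exists_lower_bound_periods hp
  refine AddSubgroup.exists_isLeast_pos ?_ ha ?_
  · rintro rfl
    obtain ⟨t, ht, ht0⟩ := h
    exact ht0.ne' ht
  · rw [Set.disjoint_left]
    rintro t ht ⟨h2, h3⟩
    exact absurd (h1.self_of_nhds t h2 (hG ht)) (not_le.2 h3)

end Periods

theorem eq_of_frequently_eq {α β : Type*} [TopologicalSpace α] [TopologicalSpace β] [T2Space β]
    {g h : α → β} {x : α} (hg : ContinuousAt g x) (hh : ContinuousAt h x)
    (hf : ∃ᶠ y in 𝓝 x, g y = h y) : g x = h x := by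
  by_contra hne
  exact hf ((hg.prodMk hh).eventually (isClosed_diagonal.isOpen_compl.mem_nhds hne))

/-! ### The smooth period function. -/

section PeriodFunction

variable {m : ℕ} {M : Type*} [TopologicalSpace M] [T2Space M] [ChartedSpace (Model m) M]
  [IsManifold (𝓡 m) ∞ M] {X : ∀ x : M, Tan m x} {φ : ℝ → M → M}

/-- Let `τ` be the least period of `p` and `K ≥ C / τ`. A point near `p` has a period in `[a, C]`,
which by compactness is near some period `kτ` of `p` with `1 ≤ k ≤ K`. As `k` divides `K!`, a
multiple of it is a period close to `K! τ`, hence equals the local return time `r`. Thus the values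
of `r` near `p` are periods. -/
theorem IsFlow.exists_pos_mem_germPeriods (hφ : IsFlow X φ) {p : M} (hp : X p ≠ 0) {C : ℝ}
    (hC : ∀ x, ∃ t, 0 < t ∧ t ≤ C ∧ φ t x = x) : ∃ t ∈ hφ.germPeriods p, 0 < t := by
  obtain ⟨τ, hτ⟩ : ∃ τ, IsLeast {t : ℝ | t ∈ hφ.periods p ∧ 0 < t} τ := by
    obtain ⟨t, ht, -, htp⟩ := hC p
    exact hφ.exists_isLeast_of_le_periods hp le_rfl ⟨t, htp, ht⟩
  have hτ0 : 0 < τ := hτ.1.2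
  have hcyc := AddSubgroup.cyclic_of_min hτ
  obtain ⟨K, hK⟩ := exists_nat_ge (C / τ)
  rw [div_le_iff₀ hτ0] at hK
  have hσ : φ ((K.factorial : ℝ) * τ) p = p := by
    have := (hφ.periods p).nsmul_mem hτ.1.1 K.factorial
    rwa [nsmul_eq_mul] at this
  obtain ⟨r, hr, hrp, hru⟩ := hφ.exists_return_time hp hσ
  obtain ⟨a, ha, hap⟩ := hφ.exists_lower_bound_periods hp
  have key : ∀ t ∈ Icc a C, ∀ᶠ z : M × ℝ in 𝓝 (p, t), φ z.2 z.1 = z.1 → φ (r z.1) z.1 = z.1 := by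
    intro t ht
    by_cases htp : φ t p = p
    · obtain ⟨k, hk⟩ : ∃ k : ℤ, k • τ = t := by
        rw [← AddSubgroup.mem_closure_singleton, ← hcyc]
        exact htp
      rw [zsmul_eq_mul] at hk
      have hk0 : 0 < k := by
        have : (0 : ℝ) < k * τ := hk ▸ ha.trans_le ht.1
        exact_mod_cast pos_of_mul_pos_left this hτ0.le
      have hkK : k ≤ K := by
        have : (k : ℝ) * τ ≤ K * τ := hk ▸ ht.2.trans hK
        exact_mod_cast le_of_mul_le_mul_right this hτ0
      obtain ⟨j, hj⟩ : ∃ j : ℤ, (K.factorial : ℤ) = j * k := by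
        lift k to ℕ using hk0.le
        obtain ⟨j, hj⟩ := Nat.dvd_factorial (by exact_mod_cast hk0) (by exact_mod_cast hkK)
        exact ⟨j, by rw [hj]; push_cast; ring⟩
      have hjσ : (j : ℝ) * t = K.factorial * τ := by
        rw [← hk, ← mul_assoc]
        congr 1
        exact_mod_cast hj.symm
      have hc : ContinuousAt (fun z : M × ℝ => ((j : ℝ) * z.2, z.1)) (p, t) := by fun_prop
      have e := hc.eventually (by simpa only [hjσ] using hru)
      filter_upwards [e] with z hz hzp
      have hmem : φ ((j : ℝ) * z.2) z.1 = z.1 := by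
        have := (hφ.periods z.1).zsmul_mem hzp j
        rwa [zsmul_eq_mul] at this
      rw [← hz hmem, hmem]
    · have hc : Continuous fun z : M × ℝ => φ z.2 z.1 := hφ.continuous.comp continuous_swap
      filter_upwards [(isClosed_eq hc continuous_fst).isOpen_compl.mem_nhds htp] with z hz h
      exact absurd h hz
  refine ⟨_, ⟨r, ⟨hr.continuousAt, ?_⟩, hrp⟩, by positivity⟩
  filter_upwards [isCompact_Icc.eventually_forall_of_forall_eventually
    (P := fun x t => φ t x = x → φ (r x) x = x) key, hap] with x h1 h2
  obtain ⟨t, ht0, htC, htx⟩ := hC x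
  exact h1 t ⟨h2 t ht0 htx, htC⟩ htx

/-- A germ of periods can be divided by `k` as soon as this is possible at points arbitrarily close
to the given one. -/
theorem IsPeriodGerm.div_natCast (hφ : IsFlow X φ) (hX : ∀ x, X x ≠ 0) {s : M → ℝ} {p : M}
    (hs : IsPeriodGerm φ s p) {k : ℕ} (hk : k ≠ 0)
    (h : ∃ᶠ y in 𝓝 p, s y / k ∈ hφ.germPeriods y) : IsPeriodGerm φ (fun y => s y / k) p := by
  have hk' : (k : ℝ) ≠ 0 := by exact_mod_cast hk
  refine ⟨hs.continuousAt.div_const _, ?_⟩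
  -- The map `f` is a `k`-th root of the identity near `p`. It is the identity near points
  -- accumulating at `p`, so by continuity it fixes `p` and has differential the identity there.
  let f : M → M := fun y => φ (s y / k) y
  have hf : ContMDiffAt (𝓡 m) (𝓡 m) ∞ f p := by
    have h1 : ContMDiffAt (𝓡 m) 𝓘(ℝ, ℝ) ∞ (fun y => s y / k) p := by
      simp only [div_eq_mul_inv]
      exact (hs.contMDiffAt hφ (hX p)).mul contMDiffAt_const
    exact ContMDiffAt.comp (f := fun y => (s y / k, y)) p (hφ.smooth (s p / k, p)) (h1.prodMk contMDiffAt_id)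
  have hid : ∃ᶠ y in 𝓝 p, f =ᶠ[𝓝 y] id := by
    refine (h.and_eventually (hs.eventually_isPeriodGerm hφ (hX p))).mono ?_
    rintro y ⟨⟨s', hs', hs'y⟩, hsy⟩
    -- The germs `s` and `k s'` agree at `y`, hence near `y`; so `s / k` equals the period `s'`
    -- there, and `f` is the identity near `y`.
    have hks' : IsPeriodGerm φ (fun z => k * s' z) y := by
      refine ⟨hs'.continuousAt.const_mul _, hs'.eventually.mono fun z hz => ?_⟩
      have := (hφ.periods z).nsmul_mem hz k
      rwa [nsmul_eq_mul] at this
    have := hsy.eventuallyEq hφ (hX y) hks' (by rw [hs'y, mul_div_cancel₀ _ hk'])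
    filter_upwards [this, hs'.eventually] with z h1 h2
    simp only [f, h1, mul_div_cancel_left₀ _ hk', h2, id]
  have hfp : f p = p :=
    eq_of_frequently_eq hf.continuousAt continuousAt_id (hid.mono fun y hy => hy.self_of_nhds)
  have hft : Tendsto f (𝓝 p) (𝓝 p) := by
    have := hf.continuousAt.tendsto
    rwa [hfp] at this
  -- Points of one orbit have the same periods, so the difference is a period of `f y`. It tends to
  -- zero, hence it vanishes near `p`. This is what lets the iterates of `f` be computed as flow
  -- maps.
  have hsf : ∀ᶠ y in 𝓝 p, s (f y) = s y := by
    have hc : Tendsto (fun y => (s (f y) - s y, f y)) (𝓝 p) (𝓝 (0, p)) := by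
      refine Tendsto.prodMk_nhds ?_ hft
      have := (hs.continuousAt.tendsto.comp hft).sub hs.continuousAt.tendsto
      rwa [sub_self] at this
    filter_upwards [hc.eventually (hφ.eventually_period_eq_zero (hX p)), hft.eventually hs.eventually,
      hs.eventually] with y h1 h2 h3
    refine sub_eq_zero.1 (h1 ?_)
    refine (hφ.periods (f y)).sub_mem h2 ?_
    rw [hφ.periods_apply]
    exact h3
  have hit : ∀ j : ℕ, ∀ᶠ y in 𝓝 p, f^[j] y = φ (j * (s y / k)) y := by
    intro j
    induction j with
    | zero => simp [hφ.zero]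
    | succ j ih =>
      filter_upwards [hft.eventually ih, hsf] with y h1 h2
      rw [Function.iterate_succ_apply, h1, h2, ← hφ.add]
      congr 1
      push_cast
      ring
  have hitk : ∀ᶠ y in 𝓝 p, f^[k] y = y := by
    filter_upwards [hit k, hs.eventually] with y h1 h2
    rw [h1, mul_div_cancel₀ _ hk', h2]
  -- pass to the chart
  let κ := extChartAt (𝓡 m) p
  have hps : p ∈ κ.source := mem_extChartAt_source p
  have hκp : κ.symm (κ p) = p := extChartAt_to_inv p
  let F : Model m → Model m := fun z => κ (f (κ.symm z))
  have hF : ContDiffAt ℝ ∞ F (κ p) := by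
    have h1 := contDiffAt_chart_of_contMDiffAt (f := fun q : ℝ × M => f q.2) (t := 0) (p := p)
      (q := p) (hf.comp (0, p) contMDiffAt_snd) (by simp only [hfp]; exact hps)
    exact ContDiffAt.comp (f := fun z : Model m => ((0 : ℝ), z)) (κ p) h1
      (contDiffAt_const.prodMk contDiffAt_id)
  have hFp : F (κ p) = κ p := by simp only [F, hκp, hfp]
  have hFt : Tendsto F (𝓝 (κ p)) (𝓝 (κ p)) := by
    have := hF.continuousAt.tendsto
    rwa [hFp] at this
  have hκt : Tendsto κ (𝓝 p) (𝓝 (κ p)) := continuousAt_extChartAt p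
  have hκst : Tendsto κ.symm (𝓝 (κ p)) (𝓝 p) := by
    have := continuousAt_extChartAt_symm (I := 𝓡 m) p
    simpa only [ContinuousAt, extChartAt_to_inv] using this
  have hsrc : ∀ᶠ y in 𝓝 p, y ∈ κ.source := (isOpen_extChartAt_source p).mem_nhds hps
  have hFid : ∃ᶠ z in 𝓝 (κ p), fderiv ℝ F z = ContinuousLinearMap.id ℝ (Model m) := by
    refine hκt.frequently ((hid.and_eventually hsrc).mono ?_)
    rintro y ⟨hy, hys⟩
    have : F =ᶠ[𝓝 (κ y)] id := by
      have hc : Tendsto κ.symm (𝓝 (κ y)) (𝓝 y) := by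
        have := continuousAt_extChartAt_symm' (I := 𝓡 m) hys
        rwa [ContinuousAt, (extChartAt (𝓡 m) p).left_inv hys] at this
      have ht : ∀ᶠ z in 𝓝 (κ y), z ∈ κ.target :=
        (isOpen_extChartAt_target p).mem_nhds (κ.map_source hys)
      filter_upwards [hc.eventually hy, ht] with z hz hzt
      simp only [F, hz, id, κ.right_inv hzt]
    rw [this.fderiv_eq, fderiv_id]
  have hF1 : ContDiffAt ℝ 1 F (κ p) := hF.of_le (by norm_cast)
  have hFd : fderiv ℝ F (κ p) = ContinuousLinearMap.id ℝ (Model m) :=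
    eq_of_frequently_eq (hF1.fderiv_right (m := 0) (by norm_num)).continuousAt continuousAt_const
      hFid
  have hFs : HasStrictFDerivAt F (ContinuousLinearMap.id ℝ (Model m)) (κ p) :=
    hFd ▸ hF1.hasStrictFDerivAt one_ne_zero
  have hFit : ∀ j : ℕ, ∀ᶠ z in 𝓝 (κ p), F^[j] z = κ (f^[j] (κ.symm z)) := by
    intro j
    induction j with
    | zero =>
      filter_upwards [(isOpen_extChartAt_target p).mem_nhds (mem_extChartAt_target p)] with z hz
      exact (κ.right_inv hz).symm
    | succ j ih =>
      filter_upwards [hFt.eventually ih, hκst.eventually (hft.eventually hsrc)] with z h1 h2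
      rw [Function.iterate_succ_apply, Function.iterate_succ_apply, h1]
      simp only [F]
      rw [κ.left_inv h2]
  have hFk : ∀ᶠ z in 𝓝 (κ p), F^[k] z = z := by
    filter_upwards [hFit k, hκst.eventually hitk,
      (isOpen_extChartAt_target p).mem_nhds (mem_extChartAt_target p)] with z h1 h2 hz
    rw [h1, h2, κ.right_inv hz]
  have := eventually_eq_self_of_iterate_eq hk hFs hFp hFk
  filter_upwards [hκt.eventually this, hsrc, hft.eventually hsrc] with y h1 h2 h3
  simp only [F, κ.left_inv h2] at h1
  exact κ.injOn h3 h2 h1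

/-- A flow without fixed points, all of whose orbits are periodic with bounded least periods, admits
a smooth invariant positive function whose values are periods. -/
theorem IsFlow.exists_period_function (hφ : IsFlow X φ) (hX : ∀ x, X x ≠ 0) {C : ℝ}
    (hC : ∀ x, ∃ t, 0 < t ∧ t ≤ C ∧ φ t x = x) :
    ∃ T : M → ℝ, ContMDiff (𝓡 m) 𝓘(ℝ, ℝ) ∞ T ∧ (∀ x, 0 < T x) ∧ (∀ x, φ (T x) x = x) ∧
      ∀ t x, T (φ t x) = T x := by
  have hT : ∀ x, ∃ T, IsLeast {t : ℝ | t ∈ hφ.germPeriods x ∧ 0 < t} T := fun x =>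
    hφ.exists_isLeast_of_le_periods (hX x) (hφ.germPeriods_le x)
      (hφ.exists_pos_mem_germPeriods (hX x) hC)
  choose T hT using hT
  refine ⟨T, fun p => ?_, fun x => (hT x).1.2, fun x => hφ.germPeriods_le x (hT x).1.1,
    fun t x => (hT (φ t x)).unique (by rw [hφ.germPeriods_apply]; exact hT x)⟩
  obtain ⟨s, hs, hsp⟩ := (hT p).1.1
  refine (hs.contMDiffAt hφ (hX p)).congr_of_eventuallyEq ?_
  obtain ⟨a, ha, hap⟩ := hφ.exists_lower_bound_periods (hX p)
  have hsp0 : 0 < s p := hsp ▸ (hT p).1.2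
  -- Near `p`, if `s y = k * T y`, then `k a ≤ s y < s p + 1 ≤ B a`; only finitely many multiples
  -- `k` have to be excluded.
  obtain ⟨B, hB⟩ := exists_nat_ge ((s p + 1) / a)
  rw [div_le_iff₀ ha] at hB
  have hne : ∀ᶠ y in 𝓝 p, ∀ k ∈ Finset.Icc 2 B, s y ≠ k * T y := by
    rw [Filter.eventually_all_finset]
    intro k hk
    have hk2 := (Finset.mem_Icc.1 hk).1
    have hk0 : (0 : ℝ) < k := by exact_mod_cast (by omega : 0 < k)
    by_contra hfr
    have hfr : ∃ᶠ y in 𝓝 p, s y / k ∈ hφ.germPeriods y := by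
      refine (not_eventually.1 hfr).mono fun y hy => ?_
      rw [not_not.1 hy, mul_div_cancel_left₀ _ hk0.ne']
      exact (hT y).1.1
    -- If `s = k T` at points accumulating at `p`, then `s / k` is a germ of periods at `p` with
    -- value `T p / k < T p`, against minimality.
    have hdiv := hs.div_natCast hφ hX (by omega) hfr
    have h1 : T p ≤ s p / k := (hT p).2 ⟨⟨_, hdiv, rfl⟩, by positivity⟩
    rw [← hsp, le_div_iff₀ hk0] at h1
    have h2 : (2 : ℝ) ≤ k := by exact_mod_cast hk2
    nlinarith
  filter_upwards [hne, hap, hs.eventually_isPeriodGerm hφ (hX p),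
    hs.continuousAt.eventually (lt_mem_nhds hsp0),
    hs.continuousAt.eventually (gt_mem_nhds (lt_add_one (s p)))] with y h1 h2 h3 h4 h5
  have hmem : s y ∈ hφ.germPeriods y := ⟨s, h3, rfl⟩
  rw [AddSubgroup.cyclic_of_min (hT y), AddSubgroup.mem_closure_singleton] at hmem
  obtain ⟨k, hk⟩ := hmem
  rw [zsmul_eq_mul] at hk
  have hTy := (hT y).1.2
  have hk0 : 0 < k := by
    have : (0 : ℝ) < k * T y := hk ▸ h4
    exact_mod_cast pos_of_mul_pos_left this hTy.le
  lift k to ℕ using hk0.le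
  have haT : a ≤ T y := h2 _ hTy (hφ.germPeriods_le y (hT y).1.1)
  simp only [Int.cast_natCast] at hk
  have hkB : k ≤ B := by
    have h6 : (0 : ℝ) ≤ k := by positivity
    have : (k : ℝ) * a < (B : ℝ) * a := by nlinarith
    exact_mod_cast (lt_of_mul_lt_mul_right this ha.le).le
  by_cases hk1 : k = 1
  · rw [hk1] at hk
    simpa using hk
  · exact absurd hk.symm (h1 k (Finset.mem_Icc.2 ⟨by omega, hkB⟩))

end PeriodFunction

/-- A positive definite continuous bilinear form on a Euclidean space has von Neumann bounded
unit ball. -/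
theorem isVonNBounded_of_pos {m : ℕ} (B : Model m →L[ℝ] Model m →L[ℝ] ℝ)
    (hB : ∀ v, v ≠ 0 → 0 < B v v) : Bornology.IsVonNBounded ℝ {v : Model m | B v v < 1} := by
  rw [NormedSpace.isVonNBounded_iff]
  obtain ⟨c, hc, hcB⟩ : ∃ c > 0, ∀ v : Metric.sphere (0 : Model m) 1, c ≤ B v v := by
    refine exists_pos_forall_of_eventually (P := fun c (v : Metric.sphere (0 : Model m) 1) =>
      c ≤ B v v) (fun c d v h h' => h.trans h') fun v => ?_
    have hv : (v : Model m) ≠ 0 := ne_zero_of_mem_unit_sphere v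
    have hpos := hB v hv
    have hcont : Continuous fun w : Metric.sphere (0 : Model m) 1 => B w w := by fun_prop
    exact ⟨B v v / 2, by positivity,
      (hcont.continuousAt.eventually (lt_mem_nhds (half_lt_self hpos))).mono fun w hw => hw.le⟩
  refine (Metric.isBounded_closedBall (x := (0 : Model m)) (r := √(1 / c))).subset fun v hv => ?_
  rw [mem_closedBall_zero_iff]
  refine Real.le_sqrt_of_sq_le ?_
  rcases eq_or_ne v 0 with rfl | hv0
  · simpa using hc.le
  · have hn : ‖v‖ ≠ 0 := norm_ne_zero_iff.2 hv0
    have h1 := hcB ⟨‖v‖⁻¹ • v, by simp [norm_smul, hn]⟩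
    simp only [map_smul, smul_eq_mul, smul_apply] at h1
    rw [le_div_iff₀ hc]
    have h2 : B v v < 1 := hv
    have h3 : ‖v‖⁻¹ * (‖v‖⁻¹ * B v v) * ‖v‖ ^ 2 = B v v := by field_simp
    nlinarith [sq_nonneg ‖v‖]

theorem apply_eq_sum_basisFun {m : ℕ} {F : Type*} [AddCommGroup F] [Module ℝ F]
    [TopologicalSpace F] (A : Model m →L[ℝ] F) (v : Model m) :
    A v = ∑ i, inner ℝ (EuclideanSpace.basisFun (Fin m) ℝ i) v •
      A (EuclideanSpace.basisFun (Fin m) ℝ i) := by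
  conv_lhs => rw [← (EuclideanSpace.basisFun (Fin m) ℝ).sum_repr' v]
  rw [map_sum]
  exact Finset.sum_congr rfl fun i _ => map_smul _ _ _

/-! ### Smooth metrics from their components. -/

section Metrics

variable {m : ℕ} {M : Type*} [TopologicalSpace M] [ChartedSpace (Model m) M]
  [IsManifold (𝓡 m) ∞ M]

theorem Metric.contMDiffAt_inner (g : Metric m M) {EN : Type*} [NormedAddCommGroup EN]
    [NormedSpace ℝ EN] {HN : Type*} [TopologicalSpace HN] {J : ModelWithCorners ℝ EN HN}
    {N : Type*} [TopologicalSpace N] [ChartedSpace HN N] {b : N → M} {v w : ∀ x, Tan m (b x)}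
    {x₀ : N} (hb : ContMDiffAt J (𝓡 m) ∞ b x₀)
    (hv : ContMDiffAt J (𝓡 m).tangent ∞ (fun x => (⟨b x, v x⟩ : TangentBundle (𝓡 m) M)) x₀)
    (hw : ContMDiffAt J (𝓡 m).tangent ∞ (fun x => (⟨b x, w x⟩ : TangentBundle (𝓡 m) M)) x₀) :
    ContMDiffAt J 𝓘(ℝ, ℝ) ∞ (fun x => g.inner (b x) (v x) (w x)) x₀ := by
  have h : ContMDiffAt J ((𝓡 m).prod 𝓘(ℝ, ℝ)) ∞ (fun x => Bundle.TotalSpace.mk' ℝ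
      (E := Bundle.Trivial M ℝ) (b x) (g.inner (b x) (v x) (w x))) x₀ := by
    refine ContMDiffAt.clm_bundle_apply₂ (F₁ := Model m) (F₂ := Model m) ?_ hv hw
    exact ContMDiffAt.comp x₀ g.contMDiff.contMDiffAt hb
  exact (Bundle.contMDiffAt_totalSpace.1 h).2

theorem contMDiffAt_coordVector {p x : M} (i : Fin m) (hx : x ∈ (extChartAt (𝓡 m) p).source) :
    ContMDiffAt (𝓡 m) (𝓡 m).tangent ∞
      (fun x => (⟨x, coordVector p i x⟩ : TangentBundle (𝓡 m) M)) x := by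
  have := IsManifold.of_le (I := 𝓡 m) (M := M) (m := 1) (n := ∞) (by norm_cast)
  let e := trivializationAt (Model m) (TangentSpace (𝓡 m) : M → Type _) p
  have hs : ∀ y ∈ (extChartAt (𝓡 m) p).source, y ∈ (chartAt (Model m) p).source := fun y hy => by
    rwa [extChartAt_source] at hy
  refine (e.contMDiffAt_section_iff (IB := 𝓡 m) (by
    rw [TangentBundle.trivializationAt_baseSet]; exact hs x hx)).2 ?_
  have hc : ContMDiffAt (𝓡 m) 𝓘(ℝ, Model m) ∞
    (fun _ : M => (EuclideanSpace.basisFun (Fin m) ℝ i : Model m)) x := contMDiffAt_const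
  refine hc.congr_of_eventuallyEq ?_
  filter_upwards [(isOpen_extChartAt_source p).mem_nhds hx] with y hy
  have h1 := e.continuousLinearMapAt_apply_of_mem (R := ℝ) (b := y)
    (by rw [TangentBundle.trivializationAt_baseSet]; exact hs y hy) (coordVector p i y)
  rw [TangentBundle.continuousLinearMapAt_trivializationAt (hs y hy)] at h1
  rw [← h1]
  have h2 := mfderiv_extChartAt_mfderiv_symm ((extChartAt (𝓡 m) p).map_source hy)
    (EuclideanSpace.basisFun (Fin m) ℝ i)
  rw [(extChartAt (𝓡 m) p).left_inv hy] at h2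
  exact h2

/-- In the trivialisation at `p` the section reads `∑ B(∂_i, ∂_j) dxⁱ ⊗ dxʲ`, with constant tensors
multiplied by the given component functions. -/
theorem contMDiffAt_of_components (B : ∀ x : M, Tan m x →L[ℝ] Tan m x →L[ℝ] ℝ) (p : M)
    (hB : ∀ i j, ContMDiffAt (𝓡 m) 𝓘(ℝ, ℝ) ∞
      (fun x => B x (coordVector p i x) (coordVector p j x)) p) :
    ContMDiffAt (𝓡 m) ((𝓡 m).prod 𝓘(ℝ, Model m →L[ℝ] Model m →L[ℝ] ℝ)) ∞
      (fun x => Bundle.TotalSpace.mk' (Model m →L[ℝ] Model m →L[ℝ] ℝ)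
        (E := fun x : M => Tan m x →L[ℝ] Tan m x →L[ℝ] ℝ) x (B x)) p := by
  have := IsManifold.of_le (I := 𝓡 m) (M := M) (m := 1) (n := ∞) (by norm_cast)
  rw [contMDiffAt_hom_bundle]
  refine ⟨contMDiffAt_id, ?_⟩
  let b := EuclideanSpace.basisFun (Fin m) ℝ
  let L : Fin m → Fin m → (Model m →L[ℝ] Model m →L[ℝ] ℝ) := fun i j =>
    ContinuousLinearMap.smulRight (innerSL ℝ (b i)) (innerSL ℝ (b j))
  have hsum : ContMDiffAt (𝓡 m) 𝓘(ℝ, Model m →L[ℝ] Model m →L[ℝ] ℝ) ∞ (fun x =>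
      ∑ i, ∑ j, B x (coordVector p i x) (coordVector p j x) • L i j) p :=
    contMDiffAt_finsetSum fun i _ => contMDiffAt_finsetSum fun j _ =>
      (hB i j).smul contMDiffAt_const
  refine hsum.congr_of_eventuallyEq ?_
  filter_upwards [(isOpen_extChartAt_source (I := 𝓡 m) p).mem_nhds (mem_extChartAt_source p)] with x hx
  have hxs : x ∈ (chartAt (Model m) p).source := by rwa [extChartAt_source] at hx
  have hS : ∀ v : Model m, (trivializationAt (Model m) (TangentSpace (𝓡 m) : M → Type _) p).symm x v
      = mfderiv 𝓘(ℝ, Model m) (𝓡 m) (extChartAt (𝓡 m) p).symm (extChartAt (𝓡 m) p x) v := by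
    intro v
    have h := TangentBundle.symmL_trivializationAt (I := 𝓡 m) hxs
    rw [ModelWithCorners.range_eq_univ, mfderivWithin_univ] at h
    rw [← Bundle.Trivialization.coe_symmₗ (R := ℝ) _ (by simpa using hxs)]
    exact congrArg (fun A => A v) h
  have hexp : ∀ v : Model m, (trivializationAt (Model m) (TangentSpace (𝓡 m) : M → Type _) p).symm x v
      = ∑ i, inner ℝ (b i) v • coordVector p i x := by
    intro v
    rw [hS]
    exact apply_eq_sum_basisFun _ v
  ext v w
  rw [inCoordinates_apply_eq₂ (by simpa using hxs) (by simpa using hxs)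
    (by simp), hexp, hexp]
  simp only [map_sum, sum_apply, map_smul, smul_apply]
  simp only [Finset.smul_sum]
  rw [Finset.sum_comm]
  refine Finset.sum_congr rfl fun i _ => Finset.sum_congr rfl fun j _ => ?_
  have ht : ∀ r : ℝ, (trivializationAt ℝ (Bundle.Trivial M ℝ) p).linearMapAt ℝ x r = r := fun r =>
    congrArg (fun A => A r) (Bundle.Trivial.linearMapAt_trivialization ℝ M ℝ x)
  refine Eq.trans (congrArg (fun r : ℝ => inner ℝ (b j) w * (inner ℝ (b i) v * r)) (ht _)) ?_
  change inner ℝ (b j) w * (inner ℝ (b i) v * B x (coordVector p i x) (coordVector p j x)) =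
    B x (coordVector p i x) (coordVector p j x) * (inner ℝ (b i) v * inner ℝ (b j) w)
  ring

theorem exists_metric_of_components (B : ∀ x : M, Tan m x →L[ℝ] Tan m x →L[ℝ] ℝ)
    (hsymm : ∀ x v w, B x v w = B x w v) (hpos : ∀ x v, v ≠ 0 → 0 < B x v v)
    (hB : ∀ p i j, ContMDiffAt (𝓡 m) 𝓘(ℝ, ℝ) ∞
      (fun x => B x (coordVector p i x) (coordVector p j x)) p) :
    ∃ g : Metric m M, ∀ x, g.inner x = B x :=
  ⟨⟨B, hsymm, hpos, fun x => isVonNBounded_of_pos (B x) (hpos x),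
    fun p => contMDiffAt_of_components B p (hB p)⟩, fun _ => rfl⟩

end Metrics

/-! ### From bounded lengths to bounded periods. -/

section PeriodBound

variable {m : ℕ} {M : Type*} [TopologicalSpace M] [CompactSpace M] [ChartedSpace (Model m) M]
  [IsManifold (𝓡 m) ∞ M] {X : ∀ x : M, Tan m x} {φ : ℝ → M → M}

/-- By compactness `|X| ≥ c > 0`, so an orbit of least period `τ` has length at least `c τ`; a bound
`L` on the lengths gives `τ ≤ L / c`. -/
theorem IsFlow.exists_period_bound (hφ : IsFlow X φ) (hX : IsSmoothField X) (hX0 : ∀ x, X x ≠ 0)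
    (hclosed : AllOrbitsClosed X) (g : Metric m M) (hbdd : BddAbove (orbitLengths g X)) :
    ∃ C, ∀ x, ∃ t, 0 < t ∧ t ≤ C ∧ φ t x = x := by
  let f : M → ℝ := fun x => √(g.inner x (X x) (X x))
  have hf : Continuous f := Real.continuous_sqrt.comp (continuous_iff_continuousAt.2 fun x =>
    (g.contMDiffAt_inner contMDiffAt_id (hX x) (hX x)).continuousAt)
  obtain ⟨c, hc, hcf⟩ : ∃ c > 0, ∀ x, c ≤ f x := by
    refine exists_pos_forall_of_eventually (P := fun c x => c ≤ f x) (fun c d v h h' => h.trans h')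
      fun x => ?_
    have hpos : 0 < f x := Real.sqrt_pos.2 (g.pos x _ (hX0 x))
    exact ⟨f x / 2, by positivity,
      (hf.continuousAt.eventually (lt_mem_nhds (half_lt_self hpos))).mono fun w hw => hw.le⟩
  obtain ⟨L, hL⟩ := hbdd
  have hper : ∀ x t, Function.Periodic (fun s => φ s x) t ↔ φ t x = x := by
    intro x t
    refine ⟨fun h => ?_, fun h s => ?_⟩
    · have := h 0
      simpa only [zero_add, hφ.zero] using this
    · simp only [hφ.add, h]
  refine ⟨L / c, fun x => ?_⟩
  obtain ⟨t, ht, htp⟩ := hclosed _ (hφ.curve x)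
  obtain ⟨τ, hτ⟩ := hφ.exists_isLeast_of_le_periods (hX0 x) le_rfl ⟨t, (hper x t).1 htp, ht⟩
  have hτ0 : 0 < τ := hτ.1.2
  refine ⟨τ, hτ0, ?_, hτ.1.1⟩
  have hmem : ∫ s in (0 : ℝ)..τ, f (φ s x) ∈ orbitLengths g X := by
    refine ⟨fun s => φ s x, τ, hφ.curve x, ?_, rfl⟩
    convert! hτ using 1
    ext s
    simp only [mem_ofPred_eq, hper]
    exact and_comm
  have hle := hL hmem
  rw [le_div_iff₀ hc, mul_comm]
  refine le_trans ?_ hle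
  have hcont : Continuous fun s => f (φ s x) :=
    hf.comp (hφ.continuous.comp (Continuous.prodMk_left x))
  have := intervalIntegral.integral_mono_on (μ := MeasureTheory.volume) (a := 0) (b := τ) (f := fun _ => c)
    (g := fun s => f (φ s x)) hτ0.le (continuous_const.intervalIntegrable _ _) (hcont.intervalIntegrable _ _)
    (fun s _ => hcf _)
  rw [intervalIntegral.integral_const, sub_zero, smul_eq_mul, mul_comm] at this
  exact this

end PeriodBound

/-! ### Rescaled flows and averaged metrics. -/

section Averaging

variable {m : ℕ} {M : Type*} [TopologicalSpace M] [ChartedSpace (Model m) M]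
  {X Y : ∀ x : M, Tan m x} {φ ψ : ℝ → M → M}

/-- The flow of `T X`, for a function `T` which is invariant under the flow of `X`. -/
theorem IsFlow.rescale (hφ : IsFlow X φ) {T : M → ℝ} (hT : ContMDiff (𝓡 m) 𝓘(ℝ, ℝ) ∞ T)
    (hTφ : ∀ t x, T (φ t x) = T x) :
    IsFlow (fun x => T x • X x) (fun t x => φ (t * T x) x) where
  smooth := hφ.smooth.comp (f := fun p : ℝ × M => (p.1 * T p.2, p.2))
    ((contMDiff_fst.mul (hT.comp contMDiff_snd)).prodMk contMDiff_snd)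
  zero x := by simp only [zero_mul, hφ.zero]
  add s t x := by simp only [hTφ, add_mul, hφ.add]
  curve x := by
    have h := (hφ.curve x).comp_mul (T x)
    intro t
    have h1 := h t
    simp only [Function.comp_apply, Pi.smul_apply] at h1
    simp only [hTφ]
    exact h1

theorem IsFlow.mdifferentiable_apply (hψ : IsFlow Y ψ) (t : ℝ) :
    MDifferentiable (𝓡 m) (𝓡 m) (ψ t) :=
  (hψ.smooth.comp (contMDiff_const.prodMk contMDiff_id)).mdifferentiable (by simp)

theorem IsFlow.mfderiv_ne_zero (hψ : IsFlow Y ψ) (t : ℝ) (x : M) {v : Tan m x} (hv : v ≠ 0) :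
    mfderiv (𝓡 m) (𝓡 m) (ψ t) x v ≠ 0 := by
  intro h
  have h1 : mfderiv (𝓡 m) (𝓡 m) (ψ (-t) ∘ ψ t) x v = 0 := by
    rw [mfderiv_comp x (hψ.mdifferentiable_apply _ _) (hψ.mdifferentiable_apply t x)]
    refine (congrArg (mfderiv (𝓡 m) (𝓡 m) (ψ (-t)) (ψ t x)) h).trans ?_
    exact map_zero _
  have h2 : ψ (-t) ∘ ψ t = id := funext (hψ.neg_apply t)
  rw [h2, mfderiv_id] at h1
  exact hv h1

/-- Differentiate `ψ_s ∘ ψ_t = ψ_t ∘ ψ_s` in `s` at `s = 0`. -/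
theorem IsFlow.mfderiv_field (hψ : IsFlow Y ψ) (t : ℝ) (x : M) :
    mfderiv (𝓡 m) (𝓡 m) (ψ t) x (Y x) = Y (ψ t x) := by
  have h1 := hψ.curve x 0
  have h2 := hψ.curve (ψ t x) 0
  have h3 : (fun s => ψ s (ψ t x)) = ψ t ∘ fun s => ψ s x := funext fun s => hψ.comm s t x
  have h4 := HasMFDerivAt.comp (0 : ℝ) (hψ.mdifferentiable_apply t (ψ 0 x)).hasMFDerivAt h1
  rw [← h3] at h4
  have h5 := congrArg (fun A => A (1 : ℝ)) (hasMFDerivAt_unique h4 h2)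
  have h6 : mfderiv (𝓡 m) (𝓡 m) (ψ t) (ψ 0 x) ((1 : ℝ) • Y (ψ 0 x)) =
    (1 : ℝ) • Y (ψ 0 (ψ t x)) := h5
  rw [one_smul, one_smul, hψ.zero, hψ.zero] at h6
  exact h6

variable [IsManifold (𝓡 m) ∞ M]

/-- The flow on the tangent bundle is smooth. -/
theorem IsFlow.contMDiff_tangent (hψ : IsFlow Y ψ) :
    ContMDiff (𝓘(ℝ, ℝ).prod (𝓡 m).tangent) (𝓡 m).tangent ∞
      (fun q : ℝ × TangentBundle (𝓡 m) M => (⟨ψ q.1 q.2.proj,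
        mfderiv (𝓡 m) (𝓡 m) (ψ q.1) q.2.proj q.2.2⟩ : TangentBundle (𝓡 m) M)) := by
  have h1 : ContMDiff (𝓘(ℝ, ℝ).prod (𝓡 m)).tangent (𝓡 m).tangent ∞
      (tangentMap (𝓘(ℝ, ℝ).prod (𝓡 m)) (𝓡 m) (fun p : ℝ × M => ψ p.1 p.2)) :=
    hψ.smooth.contMDiff_tangentMap le_rfl
  have h0 : ContMDiff 𝓘(ℝ, ℝ) 𝓘(ℝ, ℝ).tangent ∞
      (fun t : ℝ => (⟨t, 0⟩ : TangentBundle 𝓘(ℝ, ℝ) ℝ)) :=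
    Bundle.contMDiff_zeroSection ℝ (TangentSpace 𝓘(ℝ, ℝ) : ℝ → Type _)
  -- The tangent map of `(t, x) ↦ ψ t x` is restricted to vectors with zero time component.
  have h2 : ContMDiff (𝓘(ℝ, ℝ).prod (𝓡 m).tangent) (𝓘(ℝ, ℝ).tangent.prod (𝓡 m).tangent) ∞
      (fun q : ℝ × TangentBundle (𝓡 m) M => ((⟨q.1, 0⟩ : TangentBundle 𝓘(ℝ, ℝ) ℝ), q.2)) :=
    (h0.comp contMDiff_fst).prodMk contMDiff_snd
  have h3 := h1.comp ((contMDiff_equivTangentBundleProd_symm (I := 𝓘(ℝ, ℝ)) (M := ℝ) (I' := 𝓡 m)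
    (M' := M) (n := ∞)).comp h2)
  refine h3.congr fun q => ?_
  have h4 := mfderiv_prod_eq_add_apply (I := 𝓘(ℝ, ℝ)) (I' := 𝓡 m) (I'' := 𝓡 m)
    (f := fun p : ℝ × M => ψ p.1 p.2) (p := (q.1, q.2.proj)) (v := ((0 : ℝ), q.2.2))
    (hψ.smooth.mdifferentiable (by simp) _)
  have h5 : mfderiv 𝓘(ℝ, ℝ) (𝓡 m) (fun z : ℝ => ψ z q.2.proj) q.1 (0 : ℝ) = 0 := map_zero _
  have h6 : mfderiv (𝓘(ℝ, ℝ).prod (𝓡 m)) (𝓡 m) (fun p : ℝ × M => ψ p.1 p.2) (q.1, q.2.proj)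
      ((0 : ℝ), q.2.2) = mfderiv (𝓡 m) (𝓡 m) (ψ q.1) q.2.proj q.2.2 :=
    h4.trans ((congrArg (· + _) h5).trans (zero_add _))
  exact congrArg (Bundle.TotalSpace.mk (ψ q.1 q.2.proj)) h6.symm

/-- The pairing of two vectors pushed forward by a map. -/
noncomputable def Metric.pullback (g : Metric m M) (f : M → M) (x : M) (v w : Tan m x) : ℝ :=
  g.inner (f x) (mfderiv (𝓡 m) (𝓡 m) f x v) (mfderiv (𝓡 m) (𝓡 m) f x w)

theorem IsFlow.pullback_add (hψ : IsFlow Y ψ) (g : Metric m M) (s t : ℝ) (x : M) (v w : Tan m x) :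
    g.pullback (ψ (t + s)) x v w = g.pullback (ψ t) (ψ s x) (mfderiv (𝓡 m) (𝓡 m) (ψ s) x v)
      (mfderiv (𝓡 m) (𝓡 m) (ψ s) x w) := by
  have h : ψ (t + s) = ψ t ∘ ψ s := funext fun x => hψ.add t s x
  rw [h]
  simp only [Metric.pullback]
  rw [mfderiv_comp x (hψ.mdifferentiable_apply t _) (hψ.mdifferentiable_apply s x)]
  rfl

theorem IsFlow.continuous_pullback (hψ : IsFlow Y ψ) (g : Metric m M) (x : M) (v w : Tan m x) :
    Continuous fun t => g.pullback (ψ t) x v w := by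
  have h : ∀ u : Tan m x, ContMDiff 𝓘(ℝ, ℝ) (𝓡 m).tangent ∞ (fun t : ℝ => (⟨ψ t x,
      mfderiv (𝓡 m) (𝓡 m) (ψ t) x u⟩ : TangentBundle (𝓡 m) M)) := fun u =>
    hψ.contMDiff_tangent.comp (f := fun t : ℝ => (t, (⟨x, u⟩ : TangentBundle (𝓡 m) M)))
      (contMDiff_id.prodMk contMDiff_const)
  refine continuous_iff_continuousAt.2 fun t => ?_
  exact (g.contMDiffAt_inner (hψ.smooth.comp (contMDiff_id.prodMk contMDiff_const) t)
    (h v t) (h w t)).continuousAt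

/-- The average of a metric over the time interval `[0, 1]` of a flow. -/
noncomputable def IsFlow.average (hψ : IsFlow Y ψ) (g : Metric m M) (x : M) :
    Tan m x →L[ℝ] Tan m x →L[ℝ] ℝ :=
  show Model m →L[ℝ] Model m →L[ℝ] ℝ from LinearMap.toContinuousBilinearMap
    (LinearMap.mk₂ ℝ (fun v w : Model m => ∫ t in (0 : ℝ)..1, g.pullback (ψ t) x v w)
      (fun v v' w => by
        rw [← intervalIntegral.integral_add
          ((hψ.continuous_pullback g x v w).intervalIntegrable _ _)
          ((hψ.continuous_pullback g x v' w).intervalIntegrable _ _)]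
        refine intervalIntegral.integral_congr fun t _ => ?_
        simp only [Metric.pullback]
        erw [map_add, map_add]
        rfl)
      (fun c v w => by
        rw [smul_eq_mul, ← intervalIntegral.integral_const_mul]
        refine intervalIntegral.integral_congr fun t _ => ?_
        simp only [Metric.pullback]
        erw [map_smul, map_smul]
        rfl)
      (fun v w w' => by
        rw [← intervalIntegral.integral_add
          ((hψ.continuous_pullback g x v w).intervalIntegrable _ _)
          ((hψ.continuous_pullback g x v w').intervalIntegrable _ _)]
        refine intervalIntegral.integral_congr fun t _ => ?_
        simp only [Metric.pullback]
        erw [map_add, map_add])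
      (fun c v w => by
        rw [smul_eq_mul, ← intervalIntegral.integral_const_mul]
        refine intervalIntegral.integral_congr fun t _ => ?_
        simp only [Metric.pullback]
        erw [map_smul, map_smul]
        rfl))

theorem IsFlow.average_apply (hψ : IsFlow Y ψ) (g : Metric m M) (x : M) (v w : Tan m x) :
    hψ.average g x v w = ∫ t in (0 : ℝ)..1, g.pullback (ψ t) x v w := rfl

/-- Pushing forward by `ψ s` shifts the integration variable by `s`, and the integrand has period
one. -/
theorem IsFlow.average_pushforward (hψ : IsFlow Y ψ) (h1 : ∀ x, ψ 1 x = x) (g : Metric m M) (s : ℝ)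
    (x : M) (v w : Tan m x) :
    hψ.average g (ψ s x) (mfderiv (𝓡 m) (𝓡 m) (ψ s) x v) (mfderiv (𝓡 m) (𝓡 m) (ψ s) x w) =
      hψ.average g x v w := by
  have hper : Function.Periodic (fun t => g.pullback (ψ t) x v w) 1 := by
    intro t
    have : ψ (t + 1) = ψ t := funext fun x => by rw [hψ.add, h1]
    simp only [this]
  simp only [hψ.average_apply, ← hψ.pullback_add]
  rw [intervalIntegral.integral_comp_add_right (fun t => g.pullback (ψ t) x v w)]
  have := hper.intervalIntegral_add_eq s 0
  simpa only [zero_add, add_comm, add_zero] using this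

/-- The integrand is jointly smooth in time and position, so the theorem on parameter integrals
applies in the chart. -/
theorem IsFlow.contMDiffAt_average (hψ : IsFlow Y ψ) (g : Metric m M) (p : M) (i j : Fin m) :
    ContMDiffAt (𝓡 m) 𝓘(ℝ, ℝ) ∞
      (fun x => hψ.average g x (coordVector p i x) (coordVector p j x)) p := by
  simp only [hψ.average_apply]
  set κ := extChartAt (𝓡 m) p with hκ
  let F : ℝ × M → ℝ := fun q => g.pullback (ψ q.1) q.2 (coordVector p i q.2) (coordVector p j q.2)
  have hF : ∀ t, ∀ x ∈ κ.source, ContMDiffAt (𝓘(ℝ, ℝ).prod (𝓡 m)) 𝓘(ℝ, ℝ) ∞ F (t, x) := by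
    intro t x hx
    have hv : ∀ i, ContMDiffAt (𝓘(ℝ, ℝ).prod (𝓡 m)) (𝓡 m).tangent ∞ (fun q : ℝ × M =>
        (⟨ψ q.1 q.2, mfderiv (𝓡 m) (𝓡 m) (ψ q.1) q.2 (coordVector p i q.2)⟩ :
          TangentBundle (𝓡 m) M)) (t, x) := fun i =>
      ContMDiffAt.comp (g := fun q : ℝ × TangentBundle (𝓡 m) M => (⟨ψ q.1 q.2.proj,
        mfderiv (𝓡 m) (𝓡 m) (ψ q.1) q.2.proj q.2.2⟩ : TangentBundle (𝓡 m) M))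
        (f := fun q : ℝ × M => (q.1, (⟨q.2, coordVector p i q.2⟩ : TangentBundle (𝓡 m) M)))
        (t, x) (hψ.contMDiff_tangent _) (contMDiffAt_fst.prodMk
          (ContMDiffAt.comp (g := fun y => (⟨y, coordVector p i y⟩ : TangentBundle (𝓡 m) M))
            (f := fun q : ℝ × M => q.2) (t, x) (contMDiffAt_coordVector i hx) contMDiffAt_snd))
    exact g.contMDiffAt_inner (hψ.smooth (t, x)) (hv i) (hv j)
  have hG : ContDiffOn ℝ ∞ (fun z : ℝ × Model m => F (z.1, κ.symm z.2)) (univ ×ˢ κ.target) := by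
    rintro ⟨t, y⟩ ⟨-, hy⟩
    refine ContDiffAt.contDiffWithinAt ?_
    rw [← contMDiffAt_iff_contDiffAt]
    refine ContMDiffAt.comp (g := F) (f := fun z : ℝ × Model m => (z.1, κ.symm z.2)) (t, y)
      (hF t _ (κ.map_target hy)) ?_
    rw [modelWithCornersSelf_prod, ← chartedSpaceSelf_prod]
    exact contMDiffAt_fst.prodMk
      ((contMDiffAt_extChartAt_symm hy).comp (t, y) contMDiffAt_snd)
  have hI := contDiffOn_integral_unitInterval (isOpen_extChartAt_target p) hG
  have hI' := (hI.contDiffAt ((isOpen_extChartAt_target (I := 𝓡 m) p).mem_nhds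
    (mem_extChartAt_target p))).contMDiffAt
  refine (ContMDiffAt.comp p hI' (contMDiffAt_extChartAt_of_mem
    (mem_extChartAt_source p))).congr_of_eventuallyEq ?_
  filter_upwards [(isOpen_extChartAt_source (I := 𝓡 m) p).mem_nhds (mem_extChartAt_source p)]
    with x hx
  have h0 : κ.symm (κ x) = x := κ.left_inv hx
  simp only [Function.comp_apply, F, ← hκ]
  rw [h0]

/-- A smooth metric in which a given nowhere-vanishing field has a prescribed squared length. -/
theorem exists_metric_field_eq (g : Metric m M) (hY : IsSmoothField Y) (hY0 : ∀ x, Y x ≠ 0)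
    {f : M → ℝ} (hf : ContMDiff (𝓡 m) 𝓘(ℝ, ℝ) ∞ f) (hf0 : ∀ x, 0 < f x) :
    ∃ g' : Metric m M, ∀ x, g'.inner x (Y x) (Y x) = f x := by
  have hpos : ∀ x, 0 < g.inner x (Y x) (Y x) := fun x => g.pos x _ (hY0 x)
  obtain ⟨g', hg'⟩ := exists_metric_of_components
    (fun x => (f x / g.inner x (Y x) (Y x)) • g.inner x)
    (fun x v w => congrArg ((f x / g.inner x (Y x) (Y x)) * ·) (g.symm x v w))
    (fun x v hv => mul_pos (div_pos (hf0 x) (hpos x)) (g.pos x v hv))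
    (fun p i j => ((hf p).div₀ (g.contMDiffAt_inner contMDiffAt_id (hY p) (hY p))
        (hpos p).ne').smul
      (g.contMDiffAt_inner contMDiffAt_id (contMDiffAt_coordVector i (mem_extChartAt_source p))
        (contMDiffAt_coordVector j (mem_extChartAt_source p))))
  refine ⟨g', fun x => ?_⟩
  rw [hg']
  exact div_mul_cancel₀ _ (hpos x).ne'

/-- A flow of period one preserves a metric in which the squared length of its velocity is a
prescribed invariant function. -/
theorem IsFlow.exists_invariant_metric (hψ : IsFlow Y ψ) (h1 : ∀ x, ψ 1 x = x)
    (hY : IsSmoothField Y) (hY0 : ∀ x, Y x ≠ 0) (g : Metric m M)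
    {f : M → ℝ} (hf : ContMDiff (𝓡 m) 𝓘(ℝ, ℝ) ∞ f) (hf0 : ∀ x, 0 < f x)
    (hfψ : ∀ t x, f (ψ t x) = f x) :
    ∃ g' : Metric m M, (∀ t x v w, g'.pullback (ψ t) x v w = g'.inner x v w) ∧
      ∀ x, g'.inner x (Y x) (Y x) = f x := by
  -- The length is prescribed before averaging. Since `ψ t` carries `Y` to `Y` and preserves `f`,
  -- the integrand at `(Y, Y)` is constantly `f x`.
  obtain ⟨g₁, hg₁⟩ := exists_metric_field_eq g hY hY0 hf hf0
  obtain ⟨g', hg'⟩ := exists_metric_of_components (hψ.average g₁)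
    (fun x v w => by
      simp only [hψ.average_apply]
      exact intervalIntegral.integral_congr fun t _ => g₁.symm _ _ _)
    (fun x v hv => intervalIntegral.intervalIntegral_pos_of_pos
      ((hψ.continuous_pullback g₁ x v v).intervalIntegrable _ _)
      (fun t => g₁.pos _ _ (hψ.mfderiv_ne_zero t x hv)) one_pos)
    (hψ.contMDiffAt_average g₁)
  refine ⟨g', fun t x v w => ?_, fun x => ?_⟩
  · simp only [Metric.pullback, hg']
    exact hψ.average_pushforward h1 g₁ t x v w
  · rw [hg', hψ.average_apply]
    have : ∀ t, g₁.pullback (ψ t) x (Y x) (Y x) = f x := fun t => by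
      rw [Metric.pullback, hψ.mfderiv_field, hg₁, hfψ]
    simp [this]

end Averaging

/-! ### The Killing equation. -/

section Infinitesimal

variable {E : Type*} [NormedAddCommGroup E] [NormedSpace ℝ E] {Ψ : ℝ × E → E} {Y : E → E} {y₀ : E}

theorem fderiv_slice_eq (hΨ : ContDiffAt ℝ ∞ Ψ (0, y₀)) :
    ∀ᶠ t in 𝓝 (0 : ℝ), ∀ v, fderiv ℝ (fun y => Ψ (t, y)) y₀ v = fderiv ℝ Ψ (t, y₀) (0, v) := by
  have h1 : ContDiffAt ℝ 1 Ψ (0, y₀) := hΨ.of_le (by norm_cast)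
  have h2 : Tendsto (fun t : ℝ => (t, y₀)) (𝓝 0) (𝓝 (0, y₀)) :=
    (Continuous.prodMk_left y₀).tendsto 0
  filter_upwards [h2.eventually (h1.eventually (by simp))] with t ht v
  have h3 : HasFDerivAt (fun y => Ψ (t, y)) (fderiv ℝ Ψ (t, y₀) ∘L ContinuousLinearMap.inr ℝ ℝ E) y₀ :=
    (ht.differentiableAt (by simp)).hasFDerivAt.comp y₀ (hasFDerivAt_prodMk_right t y₀)
  rw [h3.fderiv]
  simp

/-- The derivative of the differential of a flow is the differential of its velocity. -/
theorem hasDerivAt_fderiv_slice (hΨ : ContDiffAt ℝ ∞ Ψ (0, y₀))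
    (hY : ∀ᶠ y in 𝓝 y₀, HasDerivAt (fun t => Ψ (t, y)) (Y y) 0) (v : E) :
    HasDerivAt (fun t => fderiv ℝ (fun y => Ψ (t, y)) y₀ v) (fderiv ℝ Y y₀ v) 0 := by
  have hd : ContDiffAt ℝ 1 (fderiv ℝ Ψ) (0, y₀) := hΨ.fderiv_right (by norm_cast)
  have hd' := (hd.differentiableAt (by simp)).hasFDerivAt
  have hsymm : IsSymmSndFDerivAt ℝ Ψ (0, y₀) := hΨ.isSymmSndFDerivAt (by
    rw [minSmoothness_of_isRCLikeNormedField]; norm_cast)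
  have h1 : HasDerivAt (fun t : ℝ => fderiv ℝ Ψ (t, y₀) (0, v))
      (fderiv ℝ (fderiv ℝ Ψ) (0, y₀) (1, 0) (0, v)) 0 := by
    have h2 : HasDerivAt (fun t : ℝ => (t, y₀)) ((1 : ℝ), (0 : E)) 0 :=
      (hasDerivAt_id 0).prodMk (hasDerivAt_const 0 y₀)
    have h3 := HasFDerivAt.comp_hasDerivAt (0 : ℝ) hd' h2
    exact (ContinuousLinearMap.apply ℝ E ((0 : ℝ), v)).hasFDerivAt.comp_hasDerivAt (0 : ℝ) h3
  -- The time and space derivatives are exchanged by symmetry of the second derivative; the time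
  -- derivative at `t = 0` is `Y`.
  have h2 : fderiv ℝ (fderiv ℝ Ψ) (0, y₀) (1, 0) (0, v) = fderiv ℝ Y y₀ v := by
    rw [hsymm (1, 0) (0, v)]
    have h3 : HasFDerivAt (fun y : E => fderiv ℝ Ψ (0, y) (1, 0))
        ((ContinuousLinearMap.apply ℝ E ((1 : ℝ), (0 : E))) ∘L
          (fderiv ℝ (fderiv ℝ Ψ) (0, y₀) ∘L ContinuousLinearMap.inr ℝ ℝ E)) y₀ :=
      (ContinuousLinearMap.apply ℝ E ((1 : ℝ), (0 : E))).hasFDerivAt.comp y₀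
        (hd'.comp y₀ (hasFDerivAt_prodMk_right 0 y₀))
    have h4 : Y =ᶠ[𝓝 y₀] fun y : E => fderiv ℝ Ψ (0, y) (1, 0) := by
      have h5 : ContDiffAt ℝ 1 Ψ (0, y₀) := hΨ.of_le (by norm_cast)
      have h6 : Tendsto (fun y : E => ((0 : ℝ), y)) (𝓝 y₀) (𝓝 (0, y₀)) :=
        (Continuous.prodMk_right (0 : ℝ)).tendsto y₀
      filter_upwards [hY, h6.eventually (h5.eventually (by simp))] with y hy hy'
      have h7 : HasDerivAt (fun t : ℝ => (t, y)) ((1 : ℝ), (0 : E)) 0 :=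
        (hasDerivAt_id 0).prodMk (hasDerivAt_const 0 y)
      have h8 := HasFDerivAt.comp_hasDerivAt (0 : ℝ)
        (hy'.differentiableAt (by simp)).hasFDerivAt h7
      exact hy.unique h8
    rw [h4.fderiv_eq, h3.fderiv]
    simp
  rw [← h2]
  refine h1.congr_of_eventuallyEq ?_
  filter_upwards [fderiv_slice_eq hΨ] with t ht
  exact ht v

theorem fderiv_slice_zero (h0 : ∀ᶠ y in 𝓝 y₀, Ψ (0, y) = y) (v : E) :
    fderiv ℝ (fun y => Ψ (0, y)) y₀ v = v := by
  have : (fun y => Ψ (0, y)) =ᶠ[𝓝 y₀] id := h0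
  rw [this.fderiv_eq, fderiv_id]
  rfl

/-- The Killing equation for the velocity of a flow which preserves a bilinear form. -/
theorem lieDerivative_eq_zero (hΨ : ContDiffAt ℝ ∞ Ψ (0, y₀)) (h0 : ∀ᶠ y in 𝓝 y₀, Ψ (0, y) = y)
    (hY : ∀ᶠ y in 𝓝 y₀, HasDerivAt (fun t => Ψ (t, y)) (Y y) 0)
    {G : E → E →L[ℝ] E →L[ℝ] ℝ} (hG : DifferentiableAt ℝ G y₀) {v w : E}
    (hinv : ∀ᶠ t in 𝓝 (0 : ℝ), G (Ψ (t, y₀)) (fderiv ℝ (fun y => Ψ (t, y)) y₀ v)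
      (fderiv ℝ (fun y => Ψ (t, y)) y₀ w) = G y₀ v w) :
    fderiv ℝ G y₀ (Y y₀) v w + G y₀ (fderiv ℝ Y y₀ v) w + G y₀ v (fderiv ℝ Y y₀ w) = 0 := by
  have hv := hasDerivAt_fderiv_slice hΨ hY v
  have hw := hasDerivAt_fderiv_slice hΨ hY w
  have h00 := h0.self_of_nhds
  have hGd : HasFDerivAt G (fderiv ℝ G y₀) (Ψ (0, y₀)) := by
    rw [h00]; exact hG.hasFDerivAt
  have h1 : HasDerivAt (fun t => G (Ψ (t, y₀))) (fderiv ℝ G y₀ (Y y₀)) 0 :=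
    HasFDerivAt.comp_hasDerivAt (E := E →L[ℝ] E →L[ℝ] ℝ) (0 : ℝ) hGd hY.self_of_nhds
  have h2 := (h1.clm_apply hv).clm_apply hw
  have h3 := h2.unique ((hasDerivAt_const (0 : ℝ) (G y₀ v w)).congr_of_eventuallyEq hinv)
  simpa [fderiv_slice_zero h0, h00] using h3

end Infinitesimal

/-! ### Divergence and invariant densities. -/

section Divergence

variable {m : ℕ}

theorem stdVol_apply (v : Fin m → Model m) :
    stdVol m v = (Matrix.of fun i j => v j i).det := rfl

theorem stdVol_basisFun : stdVol m (EuclideanSpace.basisFun (Fin m) ℝ) = 1 :=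
  (EuclideanSpace.basisFun (Fin m) ℝ).toBasis.det_self

theorem stdVol_update (i : Fin m) (a : Model m) :
    stdVol m (Function.update (EuclideanSpace.basisFun (Fin m) ℝ) i a) = a i := by
  have h : (Matrix.of fun k j => Function.update (EuclideanSpace.basisFun (Fin m) ℝ) i a j k) =
      (1 : Matrix (Fin m) (Fin m) ℝ).updateCol i a := by
    ext k j
    rcases eq_or_ne j i with rfl | hj
    · simp
    · simp [hj, Matrix.one_apply]
  rw [stdVol_apply, h, ← Matrix.cramer_apply, Matrix.cramer_one]
  rfl

/-- The divergence of a vector field on the model space. -/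
noncomputable def divergence (Z : Model m → Model m) (y : Model m) : ℝ :=
  ∑ i, fderiv ℝ Z y (EuclideanSpace.basisFun (Fin m) ℝ i) i

/-- The derivative of the determinant at the identity is the trace. -/
theorem hasDerivAt_stdVol {v : Fin m → ℝ → Model m} {v' : Fin m → Model m}
    (h : ∀ i, HasDerivAt (v i) (v' i) 0) (h0 : ∀ i, v i 0 = EuclideanSpace.basisFun (Fin m) ℝ i) :
    HasDerivAt (fun t => stdVol m fun i => v i t) (∑ i, v' i i) 0 := by
  have h1 : HasDerivAt (fun t i => v i t) v' 0 := hasDerivAt_pi.2 h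
  have h2 := ((stdVol m).hasFDerivAt fun i => v i 0).comp_hasDerivAt (0 : ℝ) h1
  convert! h2 using 1
  simp only [ContinuousMultilinearMap.linearDeriv_apply, h0]
  exact Finset.sum_congr rfl fun i _ => (stdVol_update i (v' i)).symm

/-- The Gram matrix of `v` is `Aᵀ G A`, where `A` has the vectors of `v` as columns. -/
theorem stdVol_sq_mul_det (G : Model m →L[ℝ] Model m →L[ℝ] ℝ) (v : Fin m → Model m) :
    (Matrix.of fun i j => G (v i) (v j)).det =
      stdVol m v ^ 2 * (Matrix.of fun i j => G (EuclideanSpace.basisFun (Fin m) ℝ i)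
        (EuclideanSpace.basisFun (Fin m) ℝ j)).det := by
  set e := EuclideanSpace.basisFun (Fin m) ℝ with he
  set A : Matrix (Fin m) (Fin m) ℝ := Matrix.of fun i j => v j i with hA
  have h : (Matrix.of fun i j => G (v i) (v j)) =
      A.transpose * (Matrix.of fun i j => G (e i) (e j)) * A := by
    ext i j
    have h1 : ∀ w, G w (v j) = ∑ l, v j l * G w (e l) := fun w => by
      rw [apply_eq_sum_basisFun (G w) (v j)]
      simp only [e, EuclideanSpace.basisFun_inner, smul_eq_mul]
    have h2 : G (v i) = ∑ k, v i k • G (e k) := by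
      rw [apply_eq_sum_basisFun G (v i)]
      simp only [e, EuclideanSpace.basisFun_inner]
    simp only [Matrix.mul_apply, Matrix.of_apply, Matrix.transpose_apply, hA, h1, Finset.sum_mul, h2,
      sum_apply, smul_apply, smul_eq_mul, Finset.mul_sum]
    rw [Finset.sum_comm]
    refine Finset.sum_congr rfl fun l _ => Finset.sum_congr rfl fun k _ => ?_
    ring
  rw [h, Matrix.det_mul, Matrix.det_mul, Matrix.det_transpose, stdVol_apply]
  ring

theorem divergence_smul {f : Model m → ℝ} {Z : Model m → Model m} {y : Model m}
    (hf : DifferentiableAt ℝ f y) (hZ : DifferentiableAt ℝ Z y) :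
    divergence (fun y => f y • Z y) y = f y * divergence Z y + fderiv ℝ f y (Z y) := by
  rw [apply_eq_sum_basisFun (fderiv ℝ f y) (Z y)]
  simp only [divergence, fderiv_fun_smul hf hZ, add_apply, smul_apply, Finset.mul_sum,
    ← Finset.sum_add_distrib, ContinuousLinearMap.smulRight_apply, PiLp.add_apply, PiLp.smul_apply,
    smul_eq_mul, EuclideanSpace.basisFun_inner]
  refine Finset.sum_congr rfl fun i _ => ?_
  ring

/-- A top-degree form is determined by its value on the standard basis, and here that value is the
divergence: the sign in the exterior derivative cancels the sign of moving the differentiated vector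
back to its slot. -/
theorem extDeriv_curryLeft_stdVol {n : ℕ} {Z : Model (n + 1) → Model (n + 1)} {y : Model (n + 1)}
    (hZ : DifferentiableAt ℝ Z y) (hdiv : divergence Z y = 0) :
    extDeriv (fun y => (stdVol (n + 1)).curryLeft (Z y)) y = 0 := by
  set e := EuclideanSpace.basisFun (Fin (n + 1)) ℝ with he
  have h1 : fderiv ℝ (fun y => (stdVol (n + 1)).curryLeft (Z y)) y =
      (stdVol (n + 1)).curryLeft ∘L fderiv ℝ Z y :=
    ((stdVol (n + 1)).curryLeft.hasFDerivAt.comp y hZ.hasFDerivAt).fderiv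
  set η := extDeriv (fun y => (stdVol (n + 1)).curryLeft (Z y)) y with hη
  have h2 : η e = 0 := by
    rw [hη, extDeriv, h1, ContinuousAlternatingMap.alternatizeUncurryFin_apply, ← hdiv, divergence]
    refine Finset.sum_congr rfl fun i _ => ?_
    rw [ContinuousLinearMap.comp_apply, ContinuousAlternatingMap.curryLeft_apply_apply,
      ← ContinuousAlternatingMap.map_insertNth, Fin.insertNth_removeNth, stdVol_update]
  ext v
  have h3 := congrArg (fun f => f v) (η.toAlternatingMap.eq_smul_basis_det e.toBasis)
  have h4 : η v = η e * e.toBasis.det v := by simpa using h3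
  rw [h4, h2, zero_mul]
  rfl

/-- The Riemannian density of an invariant metric is invariant under the flow. -/
theorem fderiv_density_add {Ψ : ℝ × Model m → Model m} {Y : Model m → Model m} {y₀ : Model m}
    (hΨ : ContDiffAt ℝ ∞ Ψ (0, y₀)) (h0 : ∀ᶠ y in 𝓝 y₀, Ψ (0, y) = y)
    (hY : ∀ᶠ y in 𝓝 y₀, HasDerivAt (fun t => Ψ (t, y)) (Y y) 0)
    {G : Model m → Model m →L[ℝ] Model m →L[ℝ] ℝ}
    (hinv : ∀ᶠ t in 𝓝 (0 : ℝ), ∀ v w, G (Ψ (t, y₀)) (fderiv ℝ (fun y => Ψ (t, y)) y₀ v)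
      (fderiv ℝ (fun y => Ψ (t, y)) y₀ w) = G y₀ v w)
    {ρ : Model m → ℝ} (hρ : DifferentiableAt ℝ ρ y₀) (hρ0 : ρ y₀ ≠ 0)
    (hρG : ∀ᶠ y in 𝓝 y₀, ρ y ^ 2 = (Matrix.of fun i j => G y (EuclideanSpace.basisFun (Fin m) ℝ i)
        (EuclideanSpace.basisFun (Fin m) ℝ j)).det) :
    fderiv ℝ ρ y₀ (Y y₀) + ρ y₀ * divergence Y y₀ = 0 := by
  set e := EuclideanSpace.basisFun (Fin m) ℝ with he
  have h00 := h0.self_of_nhds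
  let D : ℝ → ℝ := fun t => stdVol m fun i => fderiv ℝ (fun y => Ψ (t, y)) y₀ (e i)
  have hD : HasDerivAt D (divergence Y y₀) 0 :=
    hasDerivAt_stdVol (fun i => hasDerivAt_fderiv_slice hΨ hY (e i))
      fun i => fderiv_slice_zero h0 (e i)
  have hD0 : D 0 = 1 := by
    simp only [D, fderiv_slice_zero h0]
    exact stdVol_basisFun
  have hρd : HasFDerivAt ρ (fderiv ℝ ρ y₀) (Ψ (0, y₀)) := by
    rw [h00]; exact hρ.hasFDerivAt
  have h1 := HasFDerivAt.comp_hasDerivAt (f := fun t => Ψ (t, y₀)) (0 : ℝ) hρd hY.self_of_nhds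
  have h2 := (h1.mul hD).pow 2
  have htend : Tendsto (fun t => Ψ (t, y₀)) (𝓝 0) (𝓝 y₀) := by
    have := hY.self_of_nhds.continuousAt.tendsto
    rwa [h00] at this
  -- Invariance makes the square of density times Jacobian constant in `t`. Squaring avoids any
  -- discussion of the sign of the Jacobian; differentiating at `t = 0` and dividing by `2 ρ` gives
  -- the claim.
  have h3 : (fun t => (ρ (Ψ (t, y₀)) * D t) ^ 2) =ᶠ[𝓝 0] fun _ => ρ y₀ ^ 2 := by
    filter_upwards [hinv, htend.eventually hρG] with t ht ht'
    rw [mul_pow, ht', hρG.self_of_nhds, mul_comm, ← stdVol_sq_mul_det]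
    simp only [ht]
  have h4 := h2.unique ((hasDerivAt_const (0 : ℝ) (ρ y₀ ^ 2)).congr_of_eventuallyEq h3)
  simp [h00, hD0, hρ0] at h4
  exact h4

end Divergence

/-- If `T X` is a Killing field for `G`, where `T` is the inverse of the squared length of `X` and is
constant along `X`, then the one-form dual to `X` satisfies `ι_X dα = 0`. -/
theorem fderiv_dual_comm {E : Type*} [NormedAddCommGroup E] [NormedSpace ℝ E]
    {G : E → E →L[ℝ] E →L[ℝ] ℝ} {X : E → E} {T : E → ℝ} {y₀ : E}
    (hG : DifferentiableAt ℝ G y₀) (hX : DifferentiableAt ℝ X y₀) (hT : DifferentiableAt ℝ T y₀)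
    (hT0 : T y₀ ≠ 0) (hGX : ∀ᶠ y in 𝓝 y₀, G y (X y) (X y) = (T y)⁻¹)
    (hTX : fderiv ℝ T y₀ (X y₀) = 0) (hsymm : ∀ v w, G y₀ v w = G y₀ w v)
    (hK : ∀ v w, fderiv ℝ G y₀ (T y₀ • X y₀) v w + G y₀ (fderiv ℝ (fun y => T y • X y) y₀ v) w +
      G y₀ v (fderiv ℝ (fun y => T y • X y) y₀ w) = 0) (w : E) :
    fderiv ℝ (fun y => G y (X y)) y₀ (X y₀) w = fderiv ℝ (fun y => G y (X y)) y₀ w (X y₀) := by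
  have h1 : ∀ u v, fderiv ℝ (fun y => G y (X y)) y₀ u v =
      fderiv ℝ G y₀ u (X y₀) v + G y₀ (fderiv ℝ X y₀ u) v := by
    intro u v
    rw [(hG.hasFDerivAt.clm_apply hX.hasFDerivAt).fderiv]
    simp [add_comm]
  have h2 : ∀ u, fderiv ℝ (fun y => T y • X y) y₀ u =
      T y₀ • fderiv ℝ X y₀ u + fderiv ℝ T y₀ u • X y₀ := by
    intro u
    rw [fderiv_fun_smul hT hX]
    simp
  -- This is `G(X, X) = T⁻¹` differentiated in the direction `w`.
  have h3 : fderiv ℝ G y₀ w (X y₀) (X y₀) + 2 * G y₀ (fderiv ℝ X y₀ w) (X y₀) =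
      -fderiv ℝ T y₀ w / T y₀ ^ 2 := by
    have h4 := ((hG.hasFDerivAt.clm_apply hX.hasFDerivAt).clm_apply hX.hasFDerivAt)
    have h5 := (hasDerivAt_inv hT0).comp_hasFDerivAt y₀ hT.hasFDerivAt
    have h6 := congrArg (fun A => A w) (h4.unique (h5.congr_of_eventuallyEq hGX))
    simp at h6
    rw [hsymm (X y₀)] at h6
    rw [neg_div, div_eq_inv_mul]
    linarith
  have h7 := hK (X y₀) w
  have h8 := hGX.self_of_nhds
  simp only [h2, hTX, map_add, map_smul, smul_apply, smul_eq_mul, zero_smul, add_zero,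
    h8] at h7
  rw [h1, h1]
  rw [hsymm (X y₀)] at h7
  -- The Killing equation for `T X` on the pair `(X, w)`, divided by `T`. The derivative of `T`
  -- contributes `dT(w) G(X, X) = dT(w) / T`, and after the division this is exactly the term that
  -- cancels against `h3`.
  have h9 : fderiv ℝ G y₀ (X y₀) (X y₀) w + G y₀ (fderiv ℝ X y₀ (X y₀)) w +
      G y₀ (fderiv ℝ X y₀ w) (X y₀) + fderiv ℝ T y₀ w / T y₀ ^ 2 = 0 := by
    field_simp
    field_simp at h7
    linarith
  have h10 : -fderiv ℝ T y₀ w / T y₀ ^ 2 = -(fderiv ℝ T y₀ w / T y₀ ^ 2) := by ring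
  linarith

theorem contDiffAt_smul_const {E F : Type*} [NormedAddCommGroup E] [NormedSpace ℝ E]
    [NormedAddCommGroup F] [NormedSpace ℝ F] {f : E → ℝ} {x : E} (hf : ContDiffAt ℝ ∞ f x) (c : F) :
    ContDiffAt ℝ ∞ (fun y => f y • c) x := hf.smul contDiffAt_const

/-! ### Metrics and flows in the preferred chart. -/

section ChartMetric

variable {m : ℕ} {M : Type*} [TopologicalSpace M] [ChartedSpace (Model m) M]
  {Y : ∀ x : M, Tan m x} {ψ : ℝ → M → M}

theorem coordVector_symm {p : M} {y : Model m} (hy : y ∈ (extChartAt (𝓡 m) p).target) (i : Fin m) :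
    coordVector p i ((extChartAt (𝓡 m) p).symm y) =
      mfderiv 𝓘(ℝ, Model m) (𝓡 m) (extChartAt (𝓡 m) p).symm y
        (EuclideanSpace.basisFun (Fin m) ℝ i) := by
  rw [coordVector, (extChartAt (𝓡 m) p).right_inv hy]

/-- The expression of a flow in the preferred chart around `p`. -/
noncomputable def chartFlow (p : M) (ψ : ℝ → M → M) (q : ℝ × Model m) : Model m :=
  extChartAt (𝓡 m) p (ψ q.1 ((extChartAt (𝓡 m) p).symm q.2))

theorem IsFlow.chartFlow_zero (hψ : IsFlow Y ψ) {p : M} {y : Model m}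
    (hy : y ∈ (extChartAt (𝓡 m) p).target) : chartFlow p ψ (0, y) = y := by
  simp only [chartFlow, hψ.zero]
  exact (extChartAt (𝓡 m) p).right_inv hy

theorem IsFlow.eventually_mem_source (hψ : IsFlow Y ψ) (p : M) :
    ∀ᶠ t in 𝓝 (0 : ℝ), ψ t p ∈ (extChartAt (𝓡 m) p).source := by
  have h1 : Tendsto (fun t => ψ t p) (𝓝 0) (𝓝 p) := by
    have h2 : ContinuousAt (fun t => ψ t p) 0 :=
      (hψ.continuous.comp (Continuous.prodMk_left p)).continuousAt
    have h3 := h2.tendsto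
    rwa [hψ.zero] at h3
  exact h1.eventually (extChartAt_source_mem_nhds (I := 𝓡 m) p)

variable [IsManifold (𝓡 m) ∞ M]

/-- The expression of a metric in the preferred chart around `p`. -/
noncomputable def chartMetric (g : Metric m M) (p : M) (y : Model m) :
    Model m →L[ℝ] Model m →L[ℝ] ℝ :=
  let A : Model m →L[ℝ] Model m := mfderiv 𝓘(ℝ, Model m) (𝓡 m) (extChartAt (𝓡 m) p).symm y
  let B : Model m →L[ℝ] Model m →L[ℝ] ℝ := g.inner ((extChartAt (𝓡 m) p).symm y)
  B.bilinearComp A A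

theorem chartMetric_apply (g : Metric m M) (p : M) (y v w : Model m) :
    chartMetric g p y v w = g.inner ((extChartAt (𝓡 m) p).symm y)
      (mfderiv 𝓘(ℝ, Model m) (𝓡 m) (extChartAt (𝓡 m) p).symm y v)
      (mfderiv 𝓘(ℝ, Model m) (𝓡 m) (extChartAt (𝓡 m) p).symm y w) := rfl

theorem chartMetric_extChartAt (g : Metric m M) {p x : M} (hx : x ∈ (extChartAt (𝓡 m) p).source)
    (v w : Model m) : chartMetric g p (extChartAt (𝓡 m) p x) v w = g.inner x
      (mfderiv 𝓘(ℝ, Model m) (𝓡 m) (extChartAt (𝓡 m) p).symm (extChartAt (𝓡 m) p x) v)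
      (mfderiv 𝓘(ℝ, Model m) (𝓡 m) (extChartAt (𝓡 m) p).symm (extChartAt (𝓡 m) p x) w) := by
  rw [chartMetric_apply, (extChartAt (𝓡 m) p).left_inv hx]

theorem chartMetric_basisFun (g : Metric m M) {p : M} {y : Model m}
    (hy : y ∈ (extChartAt (𝓡 m) p).target) (i j : Fin m) :
    chartMetric g p y (EuclideanSpace.basisFun (Fin m) ℝ i) (EuclideanSpace.basisFun (Fin m) ℝ j) =
      g.inner ((extChartAt (𝓡 m) p).symm y) (coordVector p i ((extChartAt (𝓡 m) p).symm y))
        (coordVector p j ((extChartAt (𝓡 m) p).symm y)) := by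
  rw [chartMetric_apply, coordVector_symm hy, coordVector_symm hy]

theorem contDiffAt_chartMetric (g : Metric m M) (p : M) :
    ContDiffAt ℝ ∞ (chartMetric g p) (extChartAt (𝓡 m) p p) := by
  set e := EuclideanSpace.basisFun (Fin m) ℝ with he
  set κ := extChartAt (𝓡 m) p with hκ
  have hp : p ∈ κ.source := mem_extChartAt_source p
  have h1 : ∀ i j, ContDiffAt ℝ ∞ (fun y => chartMetric g p y (e i) (e j)) (κ p) := by
    intro i j
    rw [← contMDiffAt_iff_contDiffAt]
    have h2 : ContMDiffAt (𝓡 m) 𝓘(ℝ, ℝ) ∞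
        (fun x => g.inner x (coordVector p i x) (coordVector p j x)) (κ.symm (κ p)) := by
      rw [κ.left_inv hp]
      exact g.contMDiffAt_inner contMDiffAt_id (contMDiffAt_coordVector i hp)
        (contMDiffAt_coordVector j hp)
    refine (h2.comp (κ p) (contMDiffAt_extChartAt_symm (mem_extChartAt_target p))).congr_of_eventuallyEq
      ?_
    filter_upwards [extChartAt_target_mem_nhds (I := 𝓡 m) p] with y hy
    exact chartMetric_basisFun g hy i j
  let L : Fin m → Fin m → (Model m →L[ℝ] Model m →L[ℝ] ℝ) := fun i j =>
    ContinuousLinearMap.smulRight (innerSL ℝ (e i)) (innerSL ℝ (e j))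
  have h3 : chartMetric g p = fun y => ∑ i, ∑ j, chartMetric g p y (e i) (e j) • L i j := by
    funext y
    ext v w
    rw [apply_eq_sum_basisFun (chartMetric g p y) v]
    simp only [sum_apply, smul_apply, L, ContinuousLinearMap.smulRight_apply]
    refine Finset.sum_congr rfl fun i _ => ?_
    rw [apply_eq_sum_basisFun (chartMetric g p y _) w, Finset.smul_sum]
    refine Finset.sum_congr rfl fun j _ => ?_
    simp only [smul_eq_mul, innerSL_apply_apply]
    ring
  rw [h3]
  have h4 : ∀ i j, ContDiffAt ℝ ∞ (fun y => chartMetric g p y (e i) (e j) • L i j) (κ p) :=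
    fun i j => contDiffAt_smul_const (h1 i j) _
  exact ContDiffAt.sum fun i _ => ContDiffAt.sum fun j _ => h4 i j

theorem chartMetric_chartField (g : Metric m M) {p : M} {X : ∀ x : M, Tan m x} {y : Model m}
    (hy : y ∈ (extChartAt (𝓡 m) p).target) (w : Model m) :
    chartMetric g p y (chartField p X y) w = g.inner ((extChartAt (𝓡 m) p).symm y)
      (X ((extChartAt (𝓡 m) p).symm y))
      (mfderiv 𝓘(ℝ, Model m) (𝓡 m) (extChartAt (𝓡 m) p).symm y w) := by
  rw [chartMetric_apply, mfderiv_symm_chartField hy]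

theorem det_chartMetric_pos (g : Metric m M) {p : M} {y : Model m}
    (hy : y ∈ (extChartAt (𝓡 m) p).target) :
    0 < (Matrix.of fun i j => chartMetric g p y (EuclideanSpace.basisFun (Fin m) ℝ i)
      (EuclideanSpace.basisFun (Fin m) ℝ j)).det := by
  refine Matrix.PosDef.det_pos (Matrix.PosDef.of_dotProduct_mulVec_pos ?_ fun x hx => ?_)
  · ext i j
    exact g.symm _ _ _
  · let v : Model m := WithLp.toLp 2 x
    have hv : v ≠ 0 := fun h => hx (by simpa [v] using h)
    have h1 : (0 : ℝ) < chartMetric g p y v v := by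
      refine g.pos _ _ fun h => hv ?_
      exact ((mfderiv_extChartAt_mfderiv_symm hy v).symm.trans (congrArg
        (mfderiv (𝓡 m) 𝓘(ℝ, Model m) (extChartAt (𝓡 m) p) ((extChartAt (𝓡 m) p).symm y))
        h)).trans (map_zero _)
    rw [apply_eq_sum_basisFun (chartMetric g p y) v] at h1
    simp only [sum_apply, smul_apply] at h1
    convert! h1 using 1
    simp only [dotProduct, Matrix.mulVec, Matrix.of_apply]
    refine Finset.sum_congr rfl fun i _ => ?_
    rw [apply_eq_sum_basisFun (chartMetric g p y _) v]
    simp only [EuclideanSpace.basisFun_inner, smul_eq_mul, v, star_trivial]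
    congr 1
    exact Finset.sum_congr rfl fun j _ => mul_comm _ _

theorem IsFlow.contDiffAt_chartFlow (hψ : IsFlow Y ψ) (p : M) :
    ContDiffAt ℝ ∞ (chartFlow p ψ) (0, extChartAt (𝓡 m) p p) :=
  contDiffAt_chart_of_contMDiffAt (f := fun q : ℝ × M => ψ q.1 q.2) (hψ.smooth _) (by
    simp only [hψ.zero]; exact mem_extChartAt_source p)

theorem IsFlow.hasDerivAt_chartFlow (hψ : IsFlow Y ψ) {p : M} {y : Model m}
    (hy : y ∈ (extChartAt (𝓡 m) p).target) :
    HasDerivAt (fun t => chartFlow p ψ (t, y)) (chartField p Y y) 0 := by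
  set x := (extChartAt (𝓡 m) p).symm y with hx
  have hxs : x ∈ (extChartAt (𝓡 m) p).source := (extChartAt (𝓡 m) p).map_target hy
  have h1 := hψ.curve x 0
  have h2 : MDifferentiableAt (𝓡 m) 𝓘(ℝ, Model m) (extChartAt (𝓡 m) p) (ψ 0 x) := by
    rw [hψ.zero]
    exact (contMDiffAt_extChartAt_of_mem hxs).mdifferentiableAt (by simp)
  have h3 := HasMFDerivAt.comp (0 : ℝ) h2.hasMFDerivAt h1
  have h4 : HasFDerivAt (fun t => chartFlow p ψ (t, y))
      (ContinuousLinearMap.toSpanSingleton ℝ (chartField p Y y)) 0 := by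
    refine (h3.congr_mfderiv ?_).hasFDerivAt
    refine ContinuousLinearMap.ext_ring ?_
    change mfderiv (𝓡 m) 𝓘(ℝ, Model m) (extChartAt (𝓡 m) p) (ψ 0 x) ((1 : ℝ) • Y (ψ 0 x)) =
      (1 : ℝ) • chartField p Y y
    rw [one_smul, one_smul, hψ.zero]
    rfl
  simpa using h4.hasDerivAt

theorem IsFlow.fderiv_chartFlow (hψ : IsFlow Y ψ) {p : M} {t : ℝ}
    (ht : ψ t p ∈ (extChartAt (𝓡 m) p).source) (v : Model m) :
    fderiv ℝ (fun y => chartFlow p ψ (t, y)) (extChartAt (𝓡 m) p p) v =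
      mfderiv (𝓡 m) 𝓘(ℝ, Model m) (extChartAt (𝓡 m) p) (ψ t p) (mfderiv (𝓡 m) (𝓡 m) (ψ t) p
        (mfderiv 𝓘(ℝ, Model m) (𝓡 m) (extChartAt (𝓡 m) p).symm (extChartAt (𝓡 m) p p) v)) := by
  set κ := extChartAt (𝓡 m) p with hκ
  have hp : κ.symm (κ p) = p := κ.left_inv (mem_extChartAt_source p)
  have h1 : HasMFDerivAt 𝓘(ℝ, Model m) (𝓡 m) κ.symm (κ p)
      (mfderiv 𝓘(ℝ, Model m) (𝓡 m) κ.symm (κ p)) :=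
    ((contMDiffAt_extChartAt_symm (mem_extChartAt_target p)).mdifferentiableAt
      (by simp)).hasMFDerivAt
  have h2 := (hψ.mdifferentiable_apply t (κ.symm (κ p))).hasMFDerivAt
  have h3 : MDifferentiableAt (𝓡 m) 𝓘(ℝ, Model m) κ (ψ t (κ.symm (κ p))) := by
    rw [hp]
    exact (contMDiffAt_extChartAt_of_mem ht).mdifferentiableAt (by simp)
  have h4 := HasMFDerivAt.comp (κ p) h3.hasMFDerivAt (HasMFDerivAt.comp (κ p) h2 h1)
  let A : Model m →L[ℝ] Model m := (mfderiv (𝓡 m) 𝓘(ℝ, Model m) κ (ψ t (κ.symm (κ p)))).comp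
    ((mfderiv (𝓡 m) (𝓡 m) (ψ t) (κ.symm (κ p))).comp (mfderiv 𝓘(ℝ, Model m) (𝓡 m) κ.symm (κ p)))
  have h6 : HasFDerivAt (fun y => chartFlow p ψ (t, y)) A (κ p) := h4.hasFDerivAt
  have h5 : fderiv ℝ (fun y => chartFlow p ψ (t, y)) (κ p) v =
      mfderiv (𝓡 m) 𝓘(ℝ, Model m) κ (ψ t (κ.symm (κ p)))
        (mfderiv (𝓡 m) (𝓡 m) (ψ t) (κ.symm (κ p))
          (mfderiv 𝓘(ℝ, Model m) (𝓡 m) κ.symm (κ p) v)) :=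
    congrArg (fun A => A v) h6.fderiv
  rw [h5, hp]

/-- Only the centre `p` of the chart matters: the exterior derivatives at `p` are computed in the
chart around `p`, so the infinitesimal identities are needed only there. -/
theorem IsFlow.chartMetric_chartFlow (hψ : IsFlow Y ψ) {g : Metric m M} {p : M} {t : ℝ}
    (hg : ∀ v w, g.pullback (ψ t) p v w = g.inner p v w)
    (ht : ψ t p ∈ (extChartAt (𝓡 m) p).source) (v w : Model m) :
    chartMetric g p (chartFlow p ψ (t, extChartAt (𝓡 m) p p))
      (fderiv ℝ (fun y => chartFlow p ψ (t, y)) (extChartAt (𝓡 m) p p) v)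
      (fderiv ℝ (fun y => chartFlow p ψ (t, y)) (extChartAt (𝓡 m) p p) w) =
      chartMetric g p (extChartAt (𝓡 m) p p) v w := by
  have hp : (extChartAt (𝓡 m) p).symm (extChartAt (𝓡 m) p p) = p := extChartAt_to_inv p
  have h1 : chartFlow p ψ (t, extChartAt (𝓡 m) p p) = extChartAt (𝓡 m) p (ψ t p) := by
    simp only [chartFlow, hp]
  rw [h1, chartMetric_extChartAt g ht, hψ.fderiv_chartFlow ht, hψ.fderiv_chartFlow ht,
    chartMetric_extChartAt g (mem_extChartAt_source p)]
  rw [mfderiv_symm_mfderiv_extChartAt ht, mfderiv_symm_mfderiv_extChartAt ht]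
  exact hg _ _

end ChartMetric

theorem extDeriv_ofSubsingleton_apply {E : Type*} [NormedAddCommGroup E] [NormedSpace ℝ E]
    {β : E → E →L[ℝ] ℝ} {y : E} (hβ : DifferentiableAt ℝ β y) (u : Fin 2 → E) :
    extDeriv (fun y => ContinuousAlternatingMap.ofSubsingleton ℝ E ℝ (0 : Fin 1) (β y)) y u =
      fderiv ℝ β y (u 0) (u 1) - fderiv ℝ β y (u 1) (u 0) := by
  let A : (E →L[ℝ] ℝ) ≃ₗᵢ[ℝ] (E [⋀^Fin 1]→L[ℝ] ℝ) := ContinuousAlternatingMap.ofSubsingletonLIE 0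
  have h1 : HasFDerivAt
      (fun y => ContinuousAlternatingMap.ofSubsingleton ℝ E ℝ (0 : Fin 1) (β y))
      (A.toContinuousLinearEquiv.toContinuousLinearMap ∘L fderiv ℝ β y) y :=
    A.toContinuousLinearEquiv.hasFDerivAt.comp y hβ.hasFDerivAt
  rw [extDeriv, h1.fderiv, ContinuousAlternatingMap.alternatizeUncurryFin_apply, Fin.sum_univ_two]
  change (-1 : ℤ) ^ 0 • fderiv ℝ β y (u 0) (u 1) + (-1 : ℤ) ^ 1 • fderiv ℝ β y (u 1) (u 0) = _
  simp [sub_eq_add_neg]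

/-! ### The Euler equations for an invariant metric. -/

section Verification

variable {n : ℕ} {M : Type*} [TopologicalSpace M] [ChartedSpace (Model (n + 1)) M]
  {X : ∀ x : M, Tan (n + 1) x} {T : M → ℝ} {ψ : ℝ → M → M}

theorem chartField_smul (p : M) (y : Model (n + 1)) : chartField p (fun x => T x • X x) y =
    T ((extChartAt (𝓡 (n + 1)) p).symm y) • chartField p X y :=
  map_smul (mfderiv (𝓡 (n + 1)) 𝓘(ℝ, Model (n + 1)) (extChartAt (𝓡 (n + 1)) p)
    ((extChartAt (𝓡 (n + 1)) p).symm y)) _ _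

variable [IsManifold (𝓡 (n + 1)) ∞ M]

theorem contDiffAt_comp_extChartAt_symm (hT : ContMDiff (𝓡 (n + 1)) 𝓘(ℝ, ℝ) ∞ T) (p : M) :
    ContDiffAt ℝ ∞ (fun y => T ((extChartAt (𝓡 (n + 1)) p).symm y))
      (extChartAt (𝓡 (n + 1)) p p) := by
  rw [← contMDiffAt_iff_contDiffAt]
  exact (hT _).comp _ (contMDiffAt_extChartAt_symm (mem_extChartAt_target p))

/-- The function `T` is constant along `ψ`, so its derivative along `T X` is zero, and the positive
factor `T` can be divided out. -/
theorem IsFlow.fderiv_comp_chart_eq_zero (hψ : IsFlow (fun x => T x • X x) ψ)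
    (hT : ContMDiff (𝓡 (n + 1)) 𝓘(ℝ, ℝ) ∞ T) (hT0 : ∀ x, 0 < T x)
    (hTψ : ∀ t x, T (ψ t x) = T x) (p : M) :
    fderiv ℝ (fun y => T ((extChartAt (𝓡 (n + 1)) p).symm y)) (extChartAt (𝓡 (n + 1)) p p)
      (chartField p X (extChartAt (𝓡 (n + 1)) p p)) = 0 := by
  set κ := extChartAt (𝓡 (n + 1)) p with hκ
  have hp : κ.symm (κ p) = p := extChartAt_to_inv p
  have hz := hψ.chartFlow_zero (mem_extChartAt_target (I := 𝓡 (n + 1)) p)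
  have h1 : HasFDerivAt (fun y => T (κ.symm y)) (fderiv ℝ (fun y => T (κ.symm y)) (κ p))
      (chartFlow p ψ (0, κ p)) := by
    rw [hz]
    exact ((contDiffAt_comp_extChartAt_symm hT p).differentiableAt (by simp)).hasFDerivAt
  have h2 := HasFDerivAt.comp_hasDerivAt (f := fun t => chartFlow p ψ (t, κ p)) (0 : ℝ) h1
    (hψ.hasDerivAt_chartFlow (mem_extChartAt_target p))
  have h3 : ((fun y => T (κ.symm y)) ∘ fun t => chartFlow p ψ (t, κ p)) =ᶠ[𝓝 0]
      fun _ => T p := by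
    filter_upwards [hψ.eventually_mem_source p] with t ht
    have h4 : κ.symm (κ (ψ t p)) = ψ t p := κ.left_inv ht
    simp only [Function.comp_apply, chartFlow, ← hκ, hp, h4, hTψ]
  have h5 := h2.unique ((hasDerivAt_const (0 : ℝ) (T p)).congr_of_eventuallyEq h3)
  have h6 : chartField p (fun x => T x • X x) (κ p) = T (κ.symm (κ p)) • chartField p X (κ p) :=
    map_smul (mfderiv (𝓡 (n + 1)) 𝓘(ℝ, Model (n + 1)) κ (κ.symm (κ p))) _ _
  rw [h6, map_smul, smul_eq_mul, mul_eq_zero] at h5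
  exact h5.resolve_left (hT0 _).ne'

variable (hX : IsSmoothField X) (hT : ContMDiff (𝓡 (n + 1)) 𝓘(ℝ, ℝ) ∞ T) (hT0 : ∀ x, 0 < T x)
  (hψ : IsFlow (fun x => T x • X x) ψ) (hTψ : ∀ t x, T (ψ t x) = T x) {g : Metric (n + 1) M}
  (hg : ∀ t x v w, g.pullback (ψ t) x v w = g.inner x v w)

include hX hT hT0 hψ hTψ hg

/-- In the chart, `dα(X, w)` is the antisymmetrised derivative of `y ↦ G(X, ·)`. It vanishes by
`fderiv_dual_comm`, for which the invariance of `g` supplies the Killing equation of `T X`. -/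
theorem interior_d_dualForm (hgX : ∀ x, g.inner x (X x) (X x) = (T x)⁻¹) :
    (dualForm g X).d.interior X = 0 := by
  funext p
  set κ := extChartAt (𝓡 (n + 1)) p with hκ
  have hp : κ.symm (κ p) = p := extChartAt_to_inv p
  have hpt : κ p ∈ κ.target := mem_extChartAt_target p
  have htarget : κ.target ∈ 𝓝 (κ p) := extChartAt_target_mem_nhds (I := 𝓡 (n + 1)) p
  let Xc : Model (n + 1) → Model (n + 1) := chartField p X
  let G := chartMetric g p
  have hXc : DifferentiableAt ℝ Xc (κ p) :=
    ((hX.contDiffOn_chartField p).contDiffAt htarget).differentiableAt (by simp)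
  have hG : DifferentiableAt ℝ G (κ p) := (contDiffAt_chartMetric g p).differentiableAt (by simp)
  have hTc := (contDiffAt_comp_extChartAt_symm hT p).differentiableAt (by simp)
  have hcomm := fderiv_dual_comm (X := Xc) hG hXc hTc (hT0 _).ne' (by
      filter_upwards [htarget] with y hy
      rw [chartMetric_chartField g hy, mfderiv_symm_chartField hy, hgX])
    (hψ.fderiv_comp_chart_eq_zero hT hT0 hTψ p) (fun v w => g.symm _ _ _) (by
      intro v w
      have h1 := lieDerivative_eq_zero (Y := chartField p fun x => T x • X x)
        (hψ.contDiffAt_chartFlow p)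
        (by filter_upwards [htarget] with y hy using hψ.chartFlow_zero hy)
        (by filter_upwards [htarget] with y hy using hψ.hasDerivAt_chartFlow hy) hG (v := v)
        (w := w) (by
          filter_upwards [hψ.eventually_mem_source p] with t ht
          exact hψ.chartMetric_chartFlow (hg t p) ht v w)
      have h2 : (chartField p fun x => T x • X x) = fun y => T (κ.symm y) • Xc y :=
        funext fun y => chartField_smul p y
      rw [h2] at h1
      exact h1)
  have hform : (dualForm g X).inChart p =ᶠ[𝓝 (κ p)] fun y =>
      ContinuousAlternatingMap.ofSubsingleton ℝ (Model (n + 1)) ℝ (0 : Fin 1) (G y (Xc y)) := by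
    filter_upwards [htarget] with y hy
    ext v
    exact (chartMetric_chartField g hy (v 0)).symm
  have hβ : DifferentiableAt ℝ (fun y => G y (Xc y)) (κ p) := hG.clm_apply hXc
  have hX0 : mfderiv (𝓡 (n + 1)) 𝓘(ℝ, Model (n + 1)) κ p (X p) = Xc (κ p) := by
    simp only [Xc, chartField]
    rw [hp]
  ext v
  have h3 : (dualForm g X).d.interior X p v = extDeriv ((dualForm g X).inChart p) (κ p)
      (fun i => mfderiv (𝓡 (n + 1)) 𝓘(ℝ, Model (n + 1)) κ p (Matrix.vecCons (X p) v i)) := rfl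
  rw [h3, hform.extDeriv_eq]
  refine (extDeriv_ofSubsingleton_apply hβ _).trans ?_
  have h4 := hcomm (mfderiv (𝓡 (n + 1)) 𝓘(ℝ, Model (n + 1)) κ p (v 0))
  rw [← hX0] at h4
  exact sub_eq_zero.2 h4

/-- With `ρ = √(det g_ij)`, invariance under the flow of `T X` says `div (ρ T X) = 0`. As `T` is
constant along `X`, this is `T div (ρ X)`, and `ι_X μ` is the contraction of the standard volume
form with `ρ X`. -/
theorem preservesVolume_of_invariant : PreservesVolume g X := by
  intro p
  set κ := extChartAt (𝓡 (n + 1)) p with hκ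
  have hpt : κ p ∈ κ.target := mem_extChartAt_target p
  have htarget : κ.target ∈ 𝓝 (κ p) := extChartAt_target_mem_nhds (I := 𝓡 (n + 1)) p
  let Xc : Model (n + 1) → Model (n + 1) := chartField p X
  let e := EuclideanSpace.basisFun (Fin (n + 1)) ℝ
  let δ : Model (n + 1) → ℝ := fun y => (Matrix.of fun i j => chartMetric g p y (e i) (e j)).det
  have hδ : ∀ y ∈ κ.target, 0 < δ y := fun y hy => det_chartMetric_pos g hy
  have hXc : DifferentiableAt ℝ Xc (κ p) :=
    ((hX.contDiffOn_chartField p).contDiffAt htarget).differentiableAt (by simp)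
  have hG : DifferentiableAt ℝ (chartMetric g p) (κ p) :=
    (contDiffAt_chartMetric g p).differentiableAt (by simp)
  have hδd : DifferentiableAt ℝ δ (κ p) := by
    have hent : ∀ i j, ContDiffAt ℝ ∞ (fun y => chartMetric g p y (e i) (e j)) (κ p) := fun i j =>
      ((contDiffAt_chartMetric g p).clm_apply contDiffAt_const).clm_apply contDiffAt_const
    simp only [δ, Matrix.det_apply', Matrix.of_apply]
    exact DifferentiableAt.fun_sum fun σ _ =>
      ((contDiffAt_prod fun i _ => hent (σ i) i).differentiableAt (by simp)).const_mul _
  have hρd : DifferentiableAt ℝ (fun y => √(δ y)) (κ p) := hδd.sqrt (hδ _ hpt).ne'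
  have hTc := (contDiffAt_comp_extChartAt_symm hT p).differentiableAt (by simp)
  have h1 := fderiv_density_add (Y := chartField p fun x => T x • X x)
    (hψ.contDiffAt_chartFlow p)
    (by filter_upwards [htarget] with y hy using hψ.chartFlow_zero hy)
    (by filter_upwards [htarget] with y hy using hψ.hasDerivAt_chartFlow hy)
    (by
      filter_upwards [hψ.eventually_mem_source p] with t ht v w
      exact hψ.chartMetric_chartFlow (hg t p) ht v w) hρd (Real.sqrt_pos.2 (hδ _ hpt)).ne'
    (by filter_upwards [htarget] with y hy using Real.sq_sqrt (hδ y hy).le)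
  have h2 : (chartField p fun x => T x • X x) = fun y => T (κ.symm y) • Xc y :=
    funext fun y => chartField_smul p y
  have h0 : fderiv ℝ (fun y => T (κ.symm y)) (κ p) (Xc (κ p)) = 0 :=
    hψ.fderiv_comp_chart_eq_zero hT hT0 hTψ p
  have hdiv : divergence (fun y => √(δ y) • Xc y) (κ p) = 0 := by
    rw [h2, divergence_smul hTc hXc, h0, add_zero, map_smul, smul_eq_mul] at h1
    rw [divergence_smul hρd hXc]
    refine (mul_eq_zero.1 ?_).resolve_left (hT0 (κ.symm (κ p))).ne'
    linarith
  have hform : ((volumeForm g p).interior X).inChart p =ᶠ[𝓝 (κ p)] fun y =>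
      (stdVol (n + 1)).curryLeft (√(δ y) • Xc y) := by
    filter_upwards [htarget] with y hy
    have hδy : δ y = (Matrix.of fun i j => g.inner (κ.symm y) (coordVector p i (κ.symm y))
        (coordVector p j (κ.symm y))).det := by
      simp only [δ, e, chartMetric_basisFun g hy]
      rfl
    rw [map_smul, hδy]
    ext v
    have h4 : ∀ w, mfderiv (𝓡 (n + 1)) 𝓘(ℝ, Model (n + 1)) κ (κ.symm y)
      (mfderiv 𝓘(ℝ, Model (n + 1)) (𝓡 (n + 1)) κ.symm y w) = w :=
        mfderiv_extChartAt_mfderiv_symm hy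
    refine congrArg (fun r : ℝ => _ * r) (congrArg (stdVol (n + 1)) ?_)
    funext i
    refine Fin.cases rfl (fun j => ?_) i
    exact h4 (v j)
  have h5 : extDeriv (((volumeForm g p).interior X).inChart p) (κ p) = 0 := by
    rw [hform.extDeriv_eq]
    exact extDeriv_curryLeft_stdVol (hρd.smul hXc) hdiv
  ext v
  exact congrArg (fun η => η fun i => mfderiv (𝓡 (n + 1)) 𝓘(ℝ, Model (n + 1)) κ p (v i)) h5

theorem isBeltramiType_of_invariant (hgX : ∀ x, g.inner x (X x) (X x) = (T x)⁻¹) :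
    IsBeltramiType g X := by
  refine ⟨fun _ => 0, ⟨contMDiff_const, ?_, preservesVolume_of_invariant hX hT hT0 hψ hTψ hg⟩, 0,
    fun _ => rfl⟩
  rw [interior_d_dualForm hX hT hT0 hψ hTψ hg hgX]
  funext x
  ext v
  have h : mfderiv (𝓡 (n + 1)) 𝓘(ℝ, ℝ) (fun _ : M => (0 : ℝ)) x = 0 := mfderiv_const
  have h' : differential (n := n + 1) (fun _ : M => (0 : ℝ)) x v = 0 :=
    congrArg (fun A => A (v 0)) h
  exact (neg_eq_zero.2 h').symm

end Verification

end SteadyEuler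

theorem proposition4p2 {n : ℕ} {M : Type*} [TopologicalSpace M] [T2Space M] [CompactSpace M]
    [ChartedSpace (SteadyEuler.Model (n + 1)) M] [IsManifold (𝓡 (n + 1)) ∞ M]
    (X : ∀ x : M, SteadyEuler.Tan (n + 1) x)
    (hX : SteadyEuler.IsSmoothField X)
    (hX0 : ∀ x, X x ≠ 0)
    (hclosed : SteadyEuler.AllOrbitsClosed X)
    (g₀ : SteadyEuler.Metric (n + 1) M)
    (hbdd : BddAbove (SteadyEuler.orbitLengths g₀ X)) :
    ∃ g : SteadyEuler.Metric (n + 1) M, SteadyEuler.IsBeltramiType g X := by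
  obtain ⟨φ, hφ⟩ := SteadyEuler.exists_flow hX
  obtain ⟨C, hC⟩ := hφ.exists_period_bound hX hX0 hclosed g₀ hbdd
  obtain ⟨T, hT, hT0, hTper, hTφ⟩ := hφ.exists_period_function hX0 hC
  have hψ := hφ.rescale hT hTφ
  have hψT : ∀ t x, T (φ (t * T x) x) = T x := fun t x => hTφ _ x
  -- The squared length of `T X` is prescribed to be `T`, so that `g(X, X) = T⁻¹` and the dual form
  -- of `X` takes the constant value `1` on `T X`.
  obtain ⟨g, hg, hgY⟩ := hψ.exists_invariant_metric (fun x => by simp only [one_mul, hTper])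
    (hT.smul_section hX) (fun x => smul_ne_zero (hT0 x).ne' (hX0 x)) g₀ hT hT0 hψT
  refine ⟨g, SteadyEuler.isBeltramiType_of_invariant hX hT hT0 hψ hψT hg fun x => ?_⟩
  have h := hgY x
  simp only [map_smul, smul_apply, smul_eq_mul] at h
  have hne := (hT0 x).ne'
  field_simp
  exact mul_left_cancel₀ hne (by linarith)
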